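/- Fix $d,m\in\mathbb N$. Let $\bar\zeta\in W^{1,\infty}(\mathbb R^d;\mathbb R)$ (identified with its continuous representative) be such that (Z1) $\bar\zeta\in W^{1,\infty}$ and (Z2) $\operatorname{supp}\bar\zeta$ is compact; (Z3) $\sum_{\xi\in\mathbb Z^d}\bar\zeta(x-\xi)(a+b\cdot\xi)=a+b\cdot x$ for all $a\in\mathbb R$, $b,x\in\mathbb R^d$; (Z4) $\bar\zeta(0)=1$ and $\bar\zeta(\xi)=0$ for all $\xi\in\mathbb Z^d\setminus\{0\}$; (Z5) $\bar\zeta\ge 0$. For a lattice function $u:\mathbb Z^d\to\mathbb R^m$ define $\bar u,\tilde u:\mathbb R^d\to\mathbb R^m$ by $$\bar u(x)=\sum_{\xi\in\mathbb Z^d}u(\xi)\,\bar\zeta(x-\xi),\qquad \tilde u(x)=(\bar\zeta*\bar u)(x)=\int_{\mathbb R^d}\bar\zeta(x-x')\,\bar u(x')\,dx'.$$ Let $\|u\|_{\ell^p}$ be the $\ell^p(\mathbb Z^d;\mathbb R^m)$ norm, let $\|\tilde u\|_{\ell^p}$ be the $\ell^p$ norm of the restriction of $\tilde u$ to $\mathbb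 Z^d$, and let $\|\cdot\|_{L^p}$ be the norm of $L^p(\mathbb R^d)$, with Euclidean (for gradients: Frobenius) norms of the values; all norms may take the value $+\infty$. Theorem. There are constants $c_0,c_1,c_2>0$, independent of $p$ and $u$, such that for every $u:\mathbb Z^d\to\mathbb R^m$ and every $p\in[1,\infty)$ $$c_0c_1\|u\|_{\ell^p}\le\|\tilde u\|_{L^p},\qquad c_1\|\tilde u\|_{\ell^p}\le\|\tilde u\|_{L^p}\le\|\bar u\|_{L^p}\le c_2\|u\|_{\ell^p},$$ and such that, if in addition $\bar\zeta(-x)=\bar\zeta(x)$ for all $x$, then $$c_0c_1\|u\|_{\ell^p}\le c_1\|\tilde u\|_{\ell^p}$$ for every $p\in[1,\infty)$ and every $u$ of at most polynomial growth, that is, with $|u(\xi)|\le K(1+|\xi|)^N$ for some $K,N$ (in particular for every $u\in\ell^q$, $q\in[1,\infty]$). Moreover, $\bar u$ and $\tilde u$ have locally integrable weak gradients, and there is a constant $c_1'>0$, independent of $p$ and $u$, such that for every $u:\mathbb Z^d\to\mathbb R^m$ and every $p\in[1,\infty)$ $$c_1'\|\nabla\bar u\|_{L^p}\le\|\nabla\tilde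 u\|_{L^p}\le\|\nabla\bar u\|_{L^p}.$$ The inequalities $c_1\|\tilde u\|_{\ell^p}\le\|\tilde u\|_{L^p}\le\|\bar u\|_{L^p}\le c_2\|u\|_{\ell^p}$ and $\|\nabla\tilde u\|_{L^p}\le\|\nabla\bar u\|_{L^p}$ also hold for $p=\infty$. -/

import Mathlib

open MeasureTheory
open scoped ENNReal NNReal ContDiff

noncomputable section

namespace LatticeInterp

/-- The lattice site `ξ ∈ ℤ^d`, viewed as a point of `ℝ^d`. -/
def site {d : ℕ} (ξ : Fin d → ℤ) : EuclideanSpace ℝ (Fin d) :=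
  WithLp.toLp 2 (fun i => (ξ i : ℝ))

/-- `G` is the weak gradient of `f : ℝ^d → F`: both are locally integrable, and the `j`-th component of
`G` is the `j`-th distributional partial derivative of `f`. For `F = ℝ^m` the norm on the
values of `G` is the Euclidean (Frobenius) norm on `m × d` matrices. -/
structure IsWeakGradient {d : ℕ} {F : Type*} [NormedAddCommGroup F] [NormedSpace ℝ F]
    (f : EuclideanSpace ℝ (Fin d) → F)
    (G : EuclideanSpace ℝ (Fin d) → PiLp 2 (fun _ : Fin d => F)) : Prop where
  locallyIntegrable : LocallyIntegrable f volume
  locallyIntegrable_grad : LocallyIntegrable G volume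
  integral_eq : ∀ φ : EuclideanSpace ℝ (Fin d) → ℝ, ContDiff ℝ ∞ φ → HasCompactSupport φ →
    ∀ j : Fin d,
      ∫ x, (fderiv ℝ φ x (EuclideanSpace.single j 1)) • f x = - ∫ x, φ x • G x j

/-- `f ∈ W^{1,∞}(ℝ^d)`: `f` and its weak gradient are essentially bounded. -/
def MemW1Infty {d : ℕ} (f : EuclideanSpace ℝ (Fin d) → ℝ) : Prop :=
  MemLp f ∞ volume ∧
    ∃ G : EuclideanSpace ℝ (Fin d) → PiLp 2 (fun _ : Fin d => ℝ),
      IsWeakGradient f G ∧ MemLp G ∞ volume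

/-- The standing assumptions on the nodal basis function. A function in `W^{1,∞}` is identified
with its continuous representative, so that point values make sense. -/
structure IsNodalBasis {d : ℕ} (ζ : EuclideanSpace ℝ (Fin d) → ℝ) : Prop where
  /-- point values are those of the continuous representative -/
  continuous : Continuous ζ
  /-- regularity -/
  memW1Infty : MemW1Infty ζ
  /-- locality -/
  hasCompactSupport : HasCompactSupport ζ
  /-- order: affine functions are reproduced -/
  order : ∀ (a : ℝ) (b x : EuclideanSpace ℝ (Fin d)),
    ∑' ξ : Fin d → ℤ, ζ (x - site ξ) * (a + inner ℝ b (site ξ)) = a + inner ℝ b x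
  /-- invertibility -/
  at_zero : ζ 0 = 1
  at_site : ∀ ξ : Fin d → ℤ, ξ ≠ 0 → ζ (site ξ) = 0
  /-- nonnegativity -/
  nonneg : ∀ x, 0 ≤ ζ x

/-- The interpolant `ū(x) = ∑_ξ u(ξ) ζ(x - ξ)`. -/
def interp {d m : ℕ} (ζ : EuclideanSpace ℝ (Fin d) → ℝ)
    (u : (Fin d → ℤ) → EuclideanSpace ℝ (Fin m)) (x : EuclideanSpace ℝ (Fin d)) :
    EuclideanSpace ℝ (Fin m) :=
  ∑' ξ : Fin d → ℤ, ζ (x - site ξ) • u ξ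

/-- The quasi-interpolant `ũ(x) = ∫ ζ(x - y) ū(y) dy`. -/
def quasiInterp {d m : ℕ} (ζ : EuclideanSpace ℝ (Fin d) → ℝ)
    (u : (Fin d → ℤ) → EuclideanSpace ℝ (Fin m)) (x : EuclideanSpace ℝ (Fin d)) :
    EuclideanSpace ℝ (Fin m) :=
  ∫ y, ζ (x - y) • interp ζ u y

/-- The `ℓ^p` norm of a lattice function, with value `∞` allowed: the `L^p` norm for the counting
measure on `ℤ^d`. -/
def latticeNorm {d m : ℕ} (p : ℝ≥0∞) (u : (Fin d → ℤ) → EuclideanSpace ℝ (Fin m)) : ℝ≥0∞ :=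
  eLpNorm u p Measure.count

/-- `u` has at most polynomial growth. -/
def PolynomialGrowth {d m : ℕ} (u : (Fin d → ℤ) → EuclideanSpace ℝ (Fin m)) : Prop :=
  ∃ (N : ℕ) (K : ℝ), ∀ ξ, ‖u ξ‖ ≤ K * (1 + ‖site ξ‖) ^ N

end LatticeInterp

end

noncomputable section

namespace LatticeInterp

variable {d m : ℕ}

/-! ### Lattice sites -/

/-! Both `ū` and `ũ` are sums of lattice translates of one continuous, compactly supported function:
`ζ` for `ū`, and `ψ = ζ * ζ` for `ũ` (`integral_smul_interp`). The soft bounds follow from this. The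
translates of `ζ` form a partition of unity, so `ζ ≥ 0` has integral one. Convolution with `ζ` is
then an average of translates, which increases no `L^p` norm. Since only boundedly many translates
overlap, `ū` is bounded by `u`. Conversely, the value of such a sum at a point is an integral over a
unit cell against a bounded weight, the same for all sites (`exists_interp_eq_setIntegral_cell`).
Samples on any shifted lattice are therefore bounded by the `L^p` norm.

The core is the bound of an arbitrary `u` by `ũ` in `L^p`. Sampling `ũ` on `x + ℤ^d` is the action
on `u` of an element `a_x` of the group algebra `ℝ[ℤ^d]`. If the `a_x` generate the unit ideal, a
finite identity `1 = ∑ Q_x a_x` recovers `u` from finitely many families of samples, with no growth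
condition. Otherwise, by the Nullstellensatz, a complex character kills every `a_x`. It extends to
an exponential `e` on `ℝ^d`, and with `g = e ζ` the periodization of `g * g` vanishes. Its Fourier
coefficients are the squares of those of the periodization of `g`, so the latter vanishes as well.
At the origin, however, it equals `ζ 0 = 1` (`IsNodalBasis.span_sampling_mollify`).

The values on `ℤ^d` alone give only `a_0`, which may annihilate growing exponentials; hence the
growth condition. For even `ζ`, `a_0` is the Gram operator of the translates of `ζ`, pinched between
two positive constants in `ℓ²`. So `b = 1 - a_0 / L` contracts `ℓ²`. The support of `b ^ n` grows
only polynomially, so its `ℓ¹` norm still decays, and the Neumann series inverts `a_0` on functions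
of polynomial growth.

For gradients, `∇ū` vanishes on constants and is therefore bounded by finitely many lattice
differences of `u`. The stability bound applied to these differences leaves differences of `ũ`,
which are integrals of `∇ũ` along segments. -/

@[simp] lemma site_apply (ξ : Fin d → ℤ) (i : Fin d) : site ξ i = (ξ i : ℝ) := rfl

@[simp] lemma site_zero : site (0 : Fin d → ℤ) = 0 := by ext i; simp

lemma site_add (ξ η : Fin d → ℤ) : site (ξ + η) = site ξ + site η := by ext i; simp

lemma site_neg (ξ : Fin d → ℤ) : site (-ξ) = -site ξ := by ext i; simp

lemma site_sub (ξ η : Fin d → ℤ) : site (ξ - η) = site ξ - site η := by ext i; simp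

lemma finite_norm_site_le (r : ℝ) : {ξ : Fin d → ℤ | ‖site ξ‖ ≤ r}.Finite := by
  refine (Set.finite_Icc (fun _ : Fin d => -⌈r⌉) (fun _ => ⌈r⌉)).subset fun ξ hξ => ?_
  have h : ∀ i, |(ξ i : ℝ)| ≤ r := fun i =>
    (by simpa using PiLp.norm_apply_le (site ξ) i : |(ξ i : ℝ)| ≤ ‖site ξ‖).trans hξ
  refine ⟨fun i => ?_, fun i => ?_⟩
  · have := (abs_le.1 ((h i).trans (Int.le_ceil r))).1
    exact_mod_cast this
  · have := (abs_le.1 ((h i).trans (Int.le_ceil r))).2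
    exact_mod_cast this

/-- The finite set of lattice sites of norm at most `r`. -/
def latticeBall (d : ℕ) (r : ℝ) : Finset (Fin d → ℤ) := (finite_norm_site_le (d := d) r).toFinset

@[simp] lemma mem_latticeBall {r : ℝ} {ξ : Fin d → ℤ} : ξ ∈ latticeBall d r ↔ ‖site ξ‖ ≤ r := by
  simp [latticeBall]

lemma sum_latticeBall_neg {A : Type*} [AddCommMonoid A] (r : ℝ) (f : (Fin d → ℤ) → A) :
    ∑ ξ ∈ latticeBall d r, f (-ξ) = ∑ ξ ∈ latticeBall d r, f ξ :=
  Finset.sum_equiv (Equiv.neg _) (by simp [site_neg]) (by simp)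

/-! ### Rounding to the nearest lattice site -/

/-- Rounding of a point of `ℝ^d` to a lattice site, coordinate by coordinate. -/
def nearest (x : EuclideanSpace ℝ (Fin d)) : Fin d → ℤ := fun i => ⌈x i - 1 / 2⌉

lemma nearest_add_site (x : EuclideanSpace ℝ (Fin d)) (ξ : Fin d → ℤ) :
    nearest (x + site ξ) = nearest x + ξ := by
  ext i
  simp only [nearest, PiLp.add_apply, site_apply, Pi.add_apply]
  rw [show x i + (ξ i : ℝ) - 1 / 2 = (x i - 1 / 2) + (ξ i : ℝ) by ring, Int.ceil_add_intCast]

lemma measurable_nearest : Measurable (nearest (d := d)) := by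
  refine measurable_pi_lambda _ fun i => ?_
  unfold nearest
  exact Int.measurable_ceil.comp (by fun_prop)

/-- The half-open unit cell centred at the origin. -/
def cell (d : ℕ) : Set (EuclideanSpace ℝ (Fin d)) := nearest ⁻¹' {0}

lemma measurableSet_cell : MeasurableSet (cell d) :=
  measurable_nearest (measurableSet_singleton _)

/-- Rounding by the ceiling makes the cell open on the left and closed on the right, the shape in
which Fourier coefficients on the torus are written as integrals over a box. -/
lemma mem_cell {x : EuclideanSpace ℝ (Fin d)} :
    x ∈ cell d ↔ ∀ i, x i ∈ Set.Ioc (-(1 / 2) : ℝ) (1 / 2) := by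
  simp only [cell, Set.mem_preimage, Set.mem_singleton_iff, funext_iff, nearest, Pi.zero_apply,
    Int.ceil_eq_iff, Int.cast_zero, Set.mem_Ioc]
  refine forall_congr' fun i => ?_
  constructor <;> rintro ⟨h1, h2⟩ <;> constructor <;> linarith

lemma norm_le_of_mem_cell {x : EuclideanSpace ℝ (Fin d)} (hx : x ∈ cell d) : ‖x‖ ≤ d := by
  rw [mem_cell] at hx
  have h1 : ∀ i, ‖x i‖ ≤ 1 := fun i => by
    rw [Real.norm_eq_abs, abs_le]; constructor <;> linarith [(hx i).1, (hx i).2]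
  rw [EuclideanSpace.norm_eq]
  refine Real.sqrt_le_iff.2 ⟨by positivity, ?_⟩
  calc ∑ i, ‖x i‖ ^ 2 ≤ ∑ _i : Fin d, (1 : ℝ) :=
        Finset.sum_le_sum fun i _ => pow_le_one₀ (norm_nonneg _) (h1 i)
    _ = d := by simp
    _ ≤ (d : ℝ) ^ 2 := by exact_mod_cast Nat.le_self_pow two_ne_zero d

lemma cell_mem_nhds : cell d ∈ nhds (0 : EuclideanSpace ℝ (Fin d)) := by
  have : ∀ i, ∀ᶠ x in nhds (0 : EuclideanSpace ℝ (Fin d)), x i ∈ Set.Ioc (-(1 / 2) : ℝ) (1 / 2) := by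
    intro i
    have hc : Continuous fun x : EuclideanSpace ℝ (Fin d) => x i := by fun_prop
    have := hc.tendsto 0
    exact this (Ioc_mem_nhds (by simp) (by simp))
  filter_upwards [Filter.eventually_all.2 this] with x hx
  exact mem_cell.2 hx

lemma volume_cell : volume (cell d) = 1 := by
  have h : cell d = (WithLp.ofLp : EuclideanSpace ℝ (Fin d) → Fin d → ℝ) ⁻¹'
      (Set.univ.pi fun _ => Set.Ioc (-(1 / 2) : ℝ) (1 / 2)) := by
    ext x; simp [mem_cell, Set.mem_pi]
  rw [h, (PiLp.volume_preserving_ofLp (Fin d)).measure_preimage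
    (MeasurableSet.univ_pi fun _ => measurableSet_Ioc).nullMeasurableSet, Real.volume_pi_Ioc]
  norm_num

lemma nearest_preimage_singleton (ξ : Fin d → ℤ) :
    nearest ⁻¹' {ξ} = (fun x : EuclideanSpace ℝ (Fin d) => x + site (-ξ)) ⁻¹' cell d := by
  ext x
  simp [cell, nearest_add_site, add_neg_eq_zero]

/-- Each fibre is a translate of the unit cell, of volume one. Thus `ℓ^p` norms are `L^p` norms of
functions constant on cells, and both can be compared inside `L^p(ℝ^d)`. -/
lemma measurePreserving_nearest :
    MeasurePreserving (nearest (d := d)) volume Measure.count := by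
  refine ⟨measurable_nearest, Measure.ext_of_singleton fun ξ => ?_⟩
  rw [Measure.map_apply measurable_nearest (measurableSet_singleton _), nearest_preimage_singleton,
    measure_preimage_add_right, volume_cell, Measure.count_singleton]

lemma pairwise_disjoint_nearest_fiber :
    Pairwise (Function.onFun Disjoint fun ξ : Fin d → ℤ => nearest ⁻¹' {ξ}) := fun ξ η h =>
  Disjoint.preimage _ (by simpa using h)

lemma iUnion_nearest_fiber : ⋃ ξ : Fin d → ℤ, nearest ⁻¹' {ξ} = Set.univ := by
  ext x; simp

lemma setLIntegral_nearest_fiber (f : EuclideanSpace ℝ (Fin d) → ℝ≥0∞) (ξ : Fin d → ℤ) :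
    ∫⁻ x in nearest ⁻¹' {ξ}, f x = ∫⁻ x in cell d, f (x + site ξ) := by
  have := (measurePreserving_add_right (volume : Measure (EuclideanSpace ℝ (Fin d)))
    (site ξ)).setLIntegral_comp_preimage_emb (measurableEmbedding_addRight _) f (nearest ⁻¹' {ξ})
  rw [← this]
  congr 2
  ext x
  simp [cell, nearest_add_site]

lemma lintegral_eq_tsum_cell (f : EuclideanSpace ℝ (Fin d) → ℝ≥0∞) :
    ∫⁻ x, f x = ∑' ξ : Fin d → ℤ, ∫⁻ x in cell d, f (x + site ξ) := by
  rw [← setLIntegral_univ, ← iUnion_nearest_fiber, lintegral_iUnion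
    (fun ξ => measurable_nearest (measurableSet_singleton ξ)) pairwise_disjoint_nearest_fiber]
  exact tsum_congr fun ξ => setLIntegral_nearest_fiber f ξ

lemma hasSum_setIntegral_cell {F : Type*} [NormedAddCommGroup F] [NormedSpace ℝ F]
    {f : EuclideanSpace ℝ (Fin d) → F} (hf : Integrable f) :
    HasSum (fun ξ : Fin d → ℤ => ∫ x in cell d, f (x + site ξ)) (∫ x, f x) := by
  have h := hasSum_integral_iUnion (μ := volume) (f := f) (s := fun ξ : Fin d → ℤ => nearest ⁻¹' {ξ})
    (fun ξ => measurable_nearest (measurableSet_singleton ξ)) pairwise_disjoint_nearest_fiber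
    hf.integrableOn
  rw [iUnion_nearest_fiber, setIntegral_univ] at h
  convert! h using 2 with ξ
  have := (measurePreserving_add_right (volume : Measure (EuclideanSpace ℝ (Fin d)))
    (site ξ)).setIntegral_preimage_emb (measurableEmbedding_addRight _) f (nearest ⁻¹' {ξ})
  rw [← this]
  congr 2
  ext x
  simp [cell, nearest_add_site]

lemma norm_sub_site_nearest_le (x : EuclideanSpace ℝ (Fin d)) : ‖x - site (nearest x)‖ ≤ d := by
  refine norm_le_of_mem_cell ?_
  have : nearest (x + site (-nearest x)) = 0 := by rw [nearest_add_site]; simp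
  simpa [cell, site_neg, sub_eq_add_neg] using this

/-- Unfolding of the integral of a function with bounded support. -/
lemma integral_eq_setIntegral_cell_sum {F : Type*} [NormedAddCommGroup F] [NormedSpace ℝ F]
    {f : EuclideanSpace ℝ (Fin d) → F} (hf : Integrable f) {R : ℝ} (hR : ∀ x, R < ‖x‖ → f x = 0) :
    ∫ x, f x = ∫ x in cell d, ∑ ξ ∈ latticeBall d (R + d), f (x + site ξ) := by
  rw [integral_finsetSum _ fun ξ _ => (hf.comp_add_right (site ξ)).integrableOn]
  refine (hasSum_setIntegral_cell hf).unique (hasSum_sum_of_ne_finset_zero fun ξ hξ => ?_)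
  refine setIntegral_eq_zero_of_forall_eq_zero fun x hx => hR _ ?_
  simp only [mem_latticeBall, not_le] at hξ
  have h1 := norm_sub_le (x + site ξ) x
  have h2 := norm_le_of_mem_cell hx
  rw [add_sub_cancel_left] at h1
  linarith

/-! ### The interpolant as a finite sum -/

lemma _root_.HasCompactSupport.exists_forall_norm_lt_eq_zero {E F : Type*} [NormedAddCommGroup E]
    [Zero F] {f : E → F} (hf : HasCompactSupport f) : ∃ R : ℝ, 0 ≤ R ∧ ∀ x, R < ‖x‖ → f x = 0 := by
  obtain ⟨R, hR⟩ := hf.isCompact.isBounded.subset_closedBall (0 : E)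
  refine ⟨max R 0, le_max_right _ _, fun x hx => image_eq_zero_of_notMem_tsupport fun h => ?_⟩
  have := hR h
  rw [mem_closedBall_zero_iff] at this
  exact absurd (lt_of_le_of_lt (le_max_left _ _) hx) (not_lt.2 this)

lemma interp_eq_sum {θ : EuclideanSpace ℝ (Fin d) → ℝ} {R : ℝ} (hR : ∀ x, R < ‖x‖ → θ x = 0)
    (u : (Fin d → ℤ) → EuclideanSpace ℝ (Fin m)) {r : ℝ} {x : EuclideanSpace ℝ (Fin d)}
    (hx : ‖x‖ ≤ r) :
    interp θ u x = ∑ ξ ∈ latticeBall d (R + r), θ (x - site ξ) • u ξ := by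
  refine tsum_eq_sum fun ξ hξ => ?_
  simp only [mem_latticeBall, not_le] at hξ
  rw [hR, zero_smul]
  have := norm_sub_norm_le (site ξ) x
  rw [norm_sub_rev] at this
  linarith

lemma interp_add_site (θ : EuclideanSpace ℝ (Fin d) → ℝ)
    (u : (Fin d → ℤ) → EuclideanSpace ℝ (Fin m)) (x : EuclideanSpace ℝ (Fin d)) (η : Fin d → ℤ) :
    interp θ u (x + site η) = interp θ (fun ξ => u (ξ + η)) x := by
  unfold interp
  rw [← (Equiv.addRight η).tsum_eq]
  refine tsum_congr fun ξ => ?_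
  simp [site_add, add_sub_add_right_eq_sub]

lemma continuous_interp {θ : EuclideanSpace ℝ (Fin d) → ℝ} (hc : Continuous θ)
    (hs : HasCompactSupport θ) (u : (Fin d → ℤ) → EuclideanSpace ℝ (Fin m)) :
    Continuous (interp θ u) := by
  obtain ⟨R, -, hR⟩ := hs.exists_forall_norm_lt_eq_zero
  refine continuous_iff_continuousAt.2 fun x => ?_
  have h : ContinuousAt (fun y => ∑ ξ ∈ latticeBall d (R + (‖x‖ + 1)), θ (y - site ξ) • u ξ) x := by
    refine Continuous.continuousAt ?_
    fun_prop
  refine h.congr ?_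
  filter_upwards [Metric.ball_mem_nhds x one_pos] with y hy
  refine (interp_eq_sum hR u ?_).symm
  rw [Metric.mem_ball, dist_eq_norm] at hy
  have := norm_le_norm_add_norm_sub x y
  rw [norm_sub_rev] at this
  linarith

/-! ### Averages of translates do not increase `L^p` norms -/

/-- Jensen's inequality for the probability measure `μ`, then Tonelli and translation invariance of
Lebesgue measure. For `p = ∞` the exchange is made for null sets instead. A general `μ` serves two
uses: the density `ζ`, and the uniform measure on a segment. -/
lemma eLpNorm_integral_translate_le {F : Type*} [NormedAddCommGroup F] [NormedSpace ℝ F]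
    (μ : Measure (EuclideanSpace ℝ (Fin d))) [IsProbabilityMeasure μ]
    {g : EuclideanSpace ℝ (Fin d) → F} (hg : StronglyMeasurable g) {p : ℝ≥0∞} (hp : 1 ≤ p) :
    eLpNorm (fun x => ∫ y, g (x - y) ∂μ) p volume ≤ eLpNorm g p volume := by
  have hmeas : Measurable fun z : EuclideanSpace ℝ (Fin d) × EuclideanSpace ℝ (Fin d) =>
      ‖g (z.1 - z.2)‖ₑ := hg.enorm.comp (measurable_fst.sub measurable_snd)
  have hgx : ∀ x, StronglyMeasurable fun y => g (x - y) := fun x =>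
    hg.comp_measurable (measurable_const.sub measurable_id)
  rcases eq_or_ne p ⊤ with rfl | hpt
  · simp only [eLpNorm_exponent_top]
    set M := eLpNormEssSup g volume
    have h1 : ∀ᵐ x ∂(volume : Measure (EuclideanSpace ℝ (Fin d))), ∀ᵐ y ∂μ, ‖g (x - y)‖ₑ ≤ M := by
      rw [Measure.ae_ae_comm (p := fun x y => ‖g (x - y)‖ₑ ≤ M)
        (measurableSet_le hmeas measurable_const)]
      refine Filter.Eventually.of_forall fun y => ?_
      exact (measurePreserving_sub_right volume y).quasiMeasurePreserving.ae
        (enorm_ae_le_eLpNormEssSup g volume)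
    refine eLpNormEssSup_le_of_ae_enorm_bound ?_
    filter_upwards [h1] with x hx
    calc ‖∫ y, g (x - y) ∂μ‖ₑ ≤ ∫⁻ y, ‖g (x - y)‖ₑ ∂μ := enorm_integral_le_lintegral_enorm _
      _ ≤ ∫⁻ _, M ∂μ := lintegral_mono_ae hx
      _ = M := by simp
  · have hp0 : p ≠ 0 := (one_pos.trans_le hp).ne'
    rw [eLpNorm_eq_lintegral_rpow_enorm_toReal hp0 hpt, eLpNorm_eq_lintegral_rpow_enorm_toReal hp0 hpt]
    refine ENNReal.rpow_le_rpow ?_ (by positivity)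
    have hpr : 0 < p.toReal := ENNReal.toReal_pos hp0 hpt
    calc ∫⁻ x, ‖∫ y, g (x - y) ∂μ‖ₑ ^ p.toReal
        ≤ ∫⁻ x, ∫⁻ y, ‖g (x - y)‖ₑ ^ p.toReal ∂μ := by
          refine lintegral_mono fun x => ?_
          have h := eLpNorm_le_eLpNorm_of_exponent_le hp (hgx x).aestronglyMeasurable (μ := μ)
          rw [eLpNorm_one_eq_lintegral_enorm, eLpNorm_eq_lintegral_rpow_enorm_toReal hp0 hpt] at h
          calc ‖∫ y, g (x - y) ∂μ‖ₑ ^ p.toReal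
              ≤ ((∫⁻ y, ‖g (x - y)‖ₑ ^ p.toReal ∂μ) ^ (1 / p.toReal)) ^ p.toReal := by
                gcongr
                exact (enorm_integral_le_lintegral_enorm _).trans h
            _ = _ := by rw [← ENNReal.rpow_mul, one_div_mul_cancel hpr.ne', ENNReal.rpow_one]
      _ = ∫⁻ y, (∫⁻ x, ‖g (x - y)‖ₑ ^ p.toReal ∂volume) ∂μ :=
          lintegral_lintegral_swap (hmeas.pow_const _).aemeasurable
      _ = ∫⁻ _, (∫⁻ x, ‖g x‖ₑ ^ p.toReal ∂volume) ∂μ := by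
          refine lintegral_congr fun y => ?_
          exact lintegral_sub_right_eq_self (fun x => ‖g x‖ₑ ^ p.toReal) y
      _ = _ := by simp

lemma eLpNorm_mollify_le {F : Type*} [NormedAddCommGroup F] [NormedSpace ℝ F]
    {ζ : EuclideanSpace ℝ (Fin d) → ℝ} (hc : Continuous ζ) (hs : HasCompactSupport ζ)
    (h0 : ∀ x, 0 ≤ ζ x) (h1 : ∫ x, ζ x = 1)
    {g : EuclideanSpace ℝ (Fin d) → F} (hg : AEStronglyMeasurable g volume) {p : ℝ≥0∞}
    (hp : 1 ≤ p) :
    eLpNorm (fun x => ∫ y, ζ (x - y) • g y) p volume ≤ eLpNorm g p volume := by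
  let μ : Measure (EuclideanSpace ℝ (Fin d)) := volume.withDensity fun x => ENNReal.ofReal (ζ x)
  have : IsProbabilityMeasure μ := ⟨by
    rw [withDensity_apply _ MeasurableSet.univ, setLIntegral_univ,
      ← ofReal_integral_eq_lintegral_ofReal (hc.integrable_of_hasCompactSupport hs)
        (Filter.Eventually.of_forall h0), h1, ENNReal.ofReal_one]⟩
  rw [eLpNorm_congr_ae hg.ae_eq_mk]
  convert! eLpNorm_integral_translate_le μ hg.stronglyMeasurable_mk hp using 3 with x
  have h2 : ∫ y, hg.mk g (x - y) ∂μ = ∫ y, ζ y • hg.mk g (x - y) := by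
    rw [integral_withDensity_eq_integral_toReal_smul hc.measurable.ennreal_ofReal
      (Filter.Eventually.of_forall fun _ => ENNReal.ofReal_lt_top)]
    simp [ENNReal.toReal_ofReal (h0 _)]
  rw [h2, ← integral_sub_left_eq_self (fun y => ζ y • hg.mk g (x - y)) _ x]
  simp only [sub_sub_cancel]
  refine integral_congr_ae ?_
  filter_upwards [hg.ae_eq_mk] with y hy
  rw [hy]

namespace IsNodalBasis

variable {ζ : EuclideanSpace ℝ (Fin d) → ℝ}

lemma hasCompactSupport' (hζ : IsNodalBasis ζ) : ∃ R : ℝ, 0 ≤ R ∧ ∀ x, R < ‖x‖ → ζ x = 0 :=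
  hζ.hasCompactSupport.exists_forall_norm_lt_eq_zero

lemma integrable (hζ : IsNodalBasis ζ) : Integrable ζ :=
  hζ.continuous.integrable_of_hasCompactSupport hζ.hasCompactSupport

lemma tsum_eq_one (hζ : IsNodalBasis ζ) (x : EuclideanSpace ℝ (Fin d)) :
    ∑' ξ : Fin d → ℤ, ζ (x - site ξ) = 1 := by
  simpa using hζ.order 1 0 x

lemma sum_eq_one (hζ : IsNodalBasis ζ) {R : ℝ} (hR : ∀ x, R < ‖x‖ → ζ x = 0) {r : ℝ}
    {x : EuclideanSpace ℝ (Fin d)} (hx : ‖x‖ ≤ r) :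
    ∑ ξ ∈ latticeBall d (R + r), ζ (x - site ξ) = 1 := by
  rw [← hζ.tsum_eq_one x]
  refine (tsum_eq_sum fun ξ hξ => hR _ ?_).symm
  simp only [mem_latticeBall, not_le] at hξ
  have := norm_sub_norm_le (site ξ) x
  rw [norm_sub_rev] at this
  linarith

/-- Unfolding onto the cell replaces `ζ` by its periodization, which is identically one by the
partition of unity. -/
lemma integral_eq_one (hζ : IsNodalBasis ζ) : ∫ x, ζ x = 1 := by
  obtain ⟨R, -, hR⟩ := hζ.hasCompactSupport'
  rw [integral_eq_setIntegral_cell_sum hζ.integrable hR]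
  rw [setIntegral_congr_fun (g := fun _ => (1 : ℝ)) measurableSet_cell]
  · simp [Measure.real, volume_cell]
  · intro x hx
    have h := hζ.sum_eq_one hR (norm_le_of_mem_cell hx)
    rw [← h, ← sum_latticeBall_neg]
    simp only [site_neg, sub_neg_eq_add]

lemma eLpNorm_quasiInterp_le (hζ : IsNodalBasis ζ) (u : (Fin d → ℤ) → EuclideanSpace ℝ (Fin m))
    {p : ℝ≥0∞} (hp : 1 ≤ p) :
    eLpNorm (quasiInterp ζ u) p volume ≤ eLpNorm (interp ζ u) p volume :=
  eLpNorm_mollify_le hζ.continuous hζ.hasCompactSupport hζ.nonneg hζ.integral_eq_one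
    (continuous_interp hζ.continuous hζ.hasCompactSupport u).aestronglyMeasurable hp

end IsNodalBasis

/-! ### Upper bounds by lattice norms -/

lemma latticeNorm_add_right (p : ℝ≥0∞) (u : (Fin d → ℤ) → EuclideanSpace ℝ (Fin m))
    (η : Fin d → ℤ) : latticeNorm p (fun ξ => u (ξ + η)) = latticeNorm p u := by
  have h : MeasurePreserving (fun ξ : Fin d → ℤ => ξ + η) Measure.count Measure.count := by
    refine ⟨Measurable.of_discrete, Measure.ext_of_singleton fun ξ => ?_⟩
    rw [Measure.map_apply Measurable.of_discrete (measurableSet_singleton _)]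
    have : (fun ξ : Fin d → ℤ => ξ + η) ⁻¹' {ξ} = {ξ - η} := by
      ext x; simp only [Set.mem_preimage, Set.mem_singleton_iff, eq_sub_iff_add_eq]
    rw [this, Measure.count_singleton, Measure.count_singleton]
  exact eLpNorm_comp_measurePreserving (g := u) .of_discrete h

lemma eLpNorm_comp_nearest (p : ℝ≥0∞) (u : (Fin d → ℤ) → EuclideanSpace ℝ (Fin m)) :
    eLpNorm (fun x => u (nearest x)) p volume = latticeNorm p u :=
  eLpNorm_comp_measurePreserving (g := u) .of_discrete measurePreserving_nearest

/-- Minkowski's inequality for functions constant on cells. The pointwise bound is only asked almost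
everywhere because it is also applied to weak gradients. -/
lemma eLpNorm_le_sum_latticeNorm {F ι : Type*} [NormedAddCommGroup F]
    {f : EuclideanSpace ℝ (Fin d) → F} (S : Finset ι)
    (v : ι → (Fin d → ℤ) → EuclideanSpace ℝ (Fin m)) (M : ℝ≥0)
    (h : ∀ᵐ x, ‖f x‖ ≤ ∑ s ∈ S, M * ‖v s (nearest x)‖) {p : ℝ≥0∞} (hp : 1 ≤ p) :
    eLpNorm f p volume ≤ M * ∑ s ∈ S, latticeNorm p (v s) := by
  have hm : ∀ s, AEStronglyMeasurable
      (fun x : EuclideanSpace ℝ (Fin d) => (M : ℝ) * ‖v s (nearest x)‖) volume := fun s =>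
    ((Measurable.of_discrete (f := fun ξ => (M : ℝ) * ‖v s ξ‖)).comp
      measurable_nearest).aestronglyMeasurable
  calc eLpNorm f p volume ≤ eLpNorm (∑ s ∈ S, fun x => (M : ℝ) * ‖v s (nearest x)‖) p volume :=
        eLpNorm_mono_ae_real (by simpa using h)
    _ ≤ ∑ s ∈ S, eLpNorm (fun x => (M : ℝ) * ‖v s (nearest x)‖) p volume :=
        eLpNorm_sum_le (fun s _ => hm s) hp
    _ = M * ∑ s ∈ S, latticeNorm p (v s) := by
        rw [Finset.mul_sum]
        refine Finset.sum_congr rfl fun s _ => ?_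
        have := eLpNorm_const_smul (M : ℝ)
          (fun x : EuclideanSpace ℝ (Fin d) => ‖v s (nearest x)‖) p volume
        simp only [Pi.smul_def, smul_eq_mul] at this
        rw [this, eLpNorm_norm, eLpNorm_comp_nearest]
        simp

lemma eLpNorm_interp_le {θ : EuclideanSpace ℝ (Fin d) → ℝ} (hc : Continuous θ)
    (hs : HasCompactSupport θ) : ∃ C : ℝ≥0, 0 < C ∧
      ∀ (u : (Fin d → ℤ) → EuclideanSpace ℝ (Fin m)) (p : ℝ≥0∞), 1 ≤ p →
        eLpNorm (interp θ u) p volume ≤ C * latticeNorm p u := by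
  obtain ⟨R, -, hR⟩ := hs.exists_forall_norm_lt_eq_zero
  obtain ⟨M, hM⟩ := hs.exists_bound_of_continuous hc
  set S := latticeBall d (R + d)
  refine ⟨M.toNNReal * S.card + 1, by positivity, fun u p hp => ?_⟩
  have h := eLpNorm_le_sum_latticeNorm (f := interp θ u) S (fun s ξ => u (ξ + s)) M.toNNReal
    (Filter.Eventually.of_forall fun x => ?_) hp
  · refine h.trans ?_
    simp only [latticeNorm_add_right, Finset.sum_const, nsmul_eq_mul, ← mul_assoc]
    gcongr
    push_cast
    exact le_self_add
  · have hx := norm_sub_site_nearest_le x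
    have : interp θ u x = ∑ s ∈ S, θ (x - site (nearest x) - site s) • u (nearest x + s) := by
      conv_lhs => rw [← sub_add_cancel x (site (nearest x)), interp_add_site, interp_eq_sum hR _ hx]
      exact Finset.sum_congr rfl fun s _ => by rw [add_comm s]
    rw [this]
    refine (norm_sum_le _ _).trans (Finset.sum_le_sum fun s _ => ?_)
    rw [norm_smul]
    gcongr
    exact (hM _).trans (Real.le_coe_toNNReal M)

/-! ### Point values on a shifted lattice are controlled by the `L^p` norm -/

instance : IsProbabilityMeasure ((volume : Measure (EuclideanSpace ℝ (Fin d))).restrict (cell d)) :=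
  ⟨by rw [Measure.restrict_apply_univ, volume_cell]⟩

/-- Jensen's inequality on each cell, a probability space, followed by summation over the cells,
which tile `ℝ^d`. -/
lemma eLpNorm_count_le_of_cell_average {F F' : Type*} [NormedAddCommGroup F]
    [NormedAddCommGroup F'] {h : EuclideanSpace ℝ (Fin d) → F} (hh : StronglyMeasurable h)
    {a : (Fin d → ℤ) → F'} (M : ℝ≥0∞)
    (ha : ∀ ξ, ‖a ξ‖ₑ ≤ M * ∫⁻ y in cell d, ‖h (y + site ξ)‖ₑ) {p : ℝ≥0∞} (hp : 1 ≤ p) :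
    eLpNorm a p Measure.count ≤ M * eLpNorm h p volume := by
  have hhx : ∀ ξ : Fin d → ℤ, StronglyMeasurable fun y => h (y + site ξ) := fun ξ =>
    hh.comp_measurable (measurable_id.add measurable_const)
  rcases eq_or_ne p ⊤ with rfl | hpt
  · simp only [eLpNorm_exponent_top]
    refine eLpNormEssSup_le_of_ae_enorm_bound (Filter.Eventually.of_forall fun ξ => ?_)
    refine (ha ξ).trans ?_
    gcongr
    have h1 : ∀ᵐ y, ‖h (y + site ξ)‖ₑ ≤ eLpNormEssSup h volume :=
      (measurePreserving_add_right volume (site ξ)).quasiMeasurePreserving.ae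
        (enorm_ae_le_eLpNormEssSup h volume)
    calc ∫⁻ y in cell d, ‖h (y + site ξ)‖ₑ ≤ ∫⁻ y in cell d, eLpNormEssSup h volume :=
          lintegral_mono_ae (ae_restrict_of_ae h1)
      _ = _ := by simp
  · have hp0 : p ≠ 0 := (one_pos.trans_le hp).ne'
    have hpr : 0 < p.toReal := ENNReal.toReal_pos hp0 hpt
    rw [eLpNorm_eq_lintegral_rpow_enorm_toReal hp0 hpt, eLpNorm_eq_lintegral_rpow_enorm_toReal hp0 hpt,
      lintegral_count]
    have hM : M = (M ^ p.toReal) ^ (1 / p.toReal) := by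
      rw [← ENNReal.rpow_mul, mul_one_div_cancel hpr.ne', ENNReal.rpow_one]
    rw [hM, ← ENNReal.mul_rpow_of_nonneg _ _ (by positivity)]
    refine ENNReal.rpow_le_rpow ?_ (by positivity)
    rw [lintegral_eq_tsum_cell (fun x => ‖h x‖ₑ ^ p.toReal), ← ENNReal.tsum_mul_left]
    refine ENNReal.tsum_le_tsum fun ξ => ?_
    have hj := eLpNorm_le_eLpNorm_of_exponent_le hp (hhx ξ).aestronglyMeasurable
      (μ := volume.restrict (cell d))
    rw [eLpNorm_one_eq_lintegral_enorm, eLpNorm_eq_lintegral_rpow_enorm_toReal hp0 hpt] at hj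
    calc ‖a ξ‖ₑ ^ p.toReal ≤ (M * (∫⁻ y in cell d, ‖h (y + site ξ)‖ₑ ^ p.toReal) ^ (1 / p.toReal)) ^
          p.toReal := ENNReal.rpow_le_rpow ((ha ξ).trans (by gcongr)) hpr.le
      _ = _ := by
        rw [ENNReal.mul_rpow_of_nonneg _ _ hpr.le, ← ENNReal.rpow_mul,
          one_div_mul_cancel hpr.ne', ENNReal.rpow_one]

/-- A continuous function whose square integrates to zero over the unit cell vanishes at the
centre. -/
lemma eq_zero_of_setIntegral_cell_sq_eq_zero {f : EuclideanSpace ℝ (Fin d) → ℝ}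
    (hf : Continuous f) (h : ∫ x in cell d, f x ^ 2 = 0) : f 0 = 0 := by
  have hint : IntegrableOn (fun x => f x ^ 2) (cell d) := by
    refine ((hf.pow 2).continuousOn.integrableOn_compact
      (isCompact_closedBall (0 : EuclideanSpace ℝ (Fin d)) d)).mono_set fun x hx => ?_
    exact mem_closedBall_zero_iff.2 (norm_le_of_mem_cell hx)
  rw [setIntegral_eq_zero_iff_of_nonneg_ae (Filter.Eventually.of_forall fun x => sq_nonneg _) hint]
    at h
  have h' : ∀ᵐ x ∂volume.restrict (interior (cell d)), f x ^ 2 = (0 : ℝ) :=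
    ae_restrict_of_ae_restrict_of_subset interior_subset h
  have := Measure.eqOn_open_of_ae_eq (g := fun _ => (0 : ℝ)) h' isOpen_interior
    (hf.pow 2).continuousOn continuousOn_const (mem_interior_iff_mem_nhds.2 cell_mem_nhds)
  simpa using this

/-- On `x₀ + cell d` only finitely many translates are nonzero, so this is duality in a
finite-dimensional coefficient space. Point evaluation lies in the span of the `L²(cell)` pairings
with those translates as soon as it vanishes on their common kernel. Linear independence of the
translates is not needed. -/
lemma exists_interp_eq_setIntegral_cell {θ : EuclideanSpace ℝ (Fin d) → ℝ} (hc : Continuous θ)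
    (hs : HasCompactSupport θ) (x₀ : EuclideanSpace ℝ (Fin d)) :
    ∃ g : EuclideanSpace ℝ (Fin d) → ℝ, (∃ M : ℝ, ∀ y, ‖g y‖ ≤ M) ∧
      ∀ u : (Fin d → ℤ) → EuclideanSpace ℝ (Fin m),
        interp θ u x₀ = ∫ y in cell d, g y • interp θ u (x₀ + y) := by
  obtain ⟨R, -, hR⟩ := hs.exists_forall_norm_lt_eq_zero
  obtain ⟨M, hM⟩ := hs.exists_bound_of_continuous hc
  set S := latticeBall d (R + (‖x₀‖ + d)) with hS
  set f : (Fin d → ℤ) → EuclideanSpace ℝ (Fin d) → ℝ := fun ξ y => θ (x₀ + y - site ξ) with hf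
  have hfc : ∀ ξ, Continuous (f ξ) := fun ξ => by fun_prop
  have hint : ∀ k : EuclideanSpace ℝ (Fin d) → ℝ, Continuous k → IntegrableOn k (cell d) :=
    fun k hk => (hk.continuousOn.integrableOn_compact
      (isCompact_closedBall (0 : EuclideanSpace ℝ (Fin d)) d)).mono_set fun x hx =>
        mem_closedBall_zero_iff.2 (norm_le_of_mem_cell hx)
  let L : (S → ℝ) →ₗ[ℝ] ℝ := ∑ ξ : S, (f ξ 0) • LinearMap.proj ξ
  let φ : S → (S → ℝ) →ₗ[ℝ] ℝ := fun η =>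
    ∑ ξ : S, (∫ y in cell d, f ξ y * f η y) • LinearMap.proj ξ
  -- A combination orthogonal on the cell to every translate is orthogonal to itself, so its square
  -- integrates to zero and it vanishes at the centre.
  have hker : ⨅ η, LinearMap.ker (φ η) ≤ LinearMap.ker L := by
    intro c hcm
    simp only [Submodule.mem_iInf, LinearMap.mem_ker] at hcm ⊢
    have h0 : ∫ y in cell d, (∑ ξ : S, f ξ y * c ξ) ^ 2 = 0 := by
      have : ∀ y, (∑ ξ : S, f ξ y * c ξ) ^ 2
          = ∑ η : S, c η * ∑ ξ : S, (f ξ y * f η y) * c ξ := fun y => by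
        rw [sq, Finset.sum_mul_sum, Finset.sum_comm]
        refine Finset.sum_congr rfl fun η _ => ?_
        rw [Finset.mul_sum]
        exact Finset.sum_congr rfl fun ξ _ => by ring
      simp only [this]
      rw [integral_finsetSum _ fun η _ => hint _ (by fun_prop)]
      refine Finset.sum_eq_zero fun η _ => ?_
      rw [integral_const_mul, integral_finsetSum _ fun η _ => hint _ (by fun_prop)]
      have := hcm η
      simp only [φ, LinearMap.sum_apply, LinearMap.smul_apply, LinearMap.proj_apply,
        smul_eq_mul] at this
      simp only [integral_mul_const, this, mul_zero]
    have := eq_zero_of_setIntegral_cell_sq_eq_zero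
      (f := fun y => ∑ ξ : S, f ξ y * c ξ) (by fun_prop) h0
    simpa [L] using this
  obtain ⟨a, ha⟩ := (Submodule.mem_span_range_iff_exists_fun ℝ).1 (mem_span_of_iInf_ker_le_ker hker)
  have hval : ∀ ξ : S, f ξ 0 = ∫ y in cell d, (∑ η : S, a η * f η y) * f ξ y := fun ξ => by
    have h1 := congrArg (fun l : (S → ℝ) →ₗ[ℝ] ℝ => l (Pi.single ξ 1)) ha
    simp only [L, φ, LinearMap.sum_apply, LinearMap.smul_apply, LinearMap.proj_apply,
      smul_eq_mul, Pi.single_apply, mul_ite, mul_one, mul_zero, Finset.sum_ite_eq',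
      Finset.mem_univ, if_true] at h1
    rw [← h1]
    simp only [Finset.sum_mul]
    rw [integral_finsetSum _ fun η _ => hint _ (by fun_prop)]
    refine Finset.sum_congr rfl fun η _ => ?_
    rw [← integral_const_mul]
    exact integral_congr_ae (Filter.Eventually.of_forall fun y => by dsimp only; ring)
  refine ⟨fun y => ∑ η : S, a η * f η y, ⟨∑ η : S, ‖a η‖ * M, fun y => ?_⟩, fun u => ?_⟩
  · refine (norm_sum_le _ _).trans (Finset.sum_le_sum fun η _ => ?_)
    rw [norm_mul]
    gcongr
    exact hM _
  · have h1 : ∀ y ∈ cell d, (∑ η : S, a η * f η y) • interp θ u (x₀ + y)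
        = ∑ ξ : S, ((∑ η : S, a η * f η y) * f ξ y) • u ξ := fun y hy => by
      rw [interp_eq_sum hR u (r := ‖x₀‖ + d)
        ((norm_add_le _ _).trans (by gcongr; exact norm_le_of_mem_cell hy)), ← hS,
        ← Finset.sum_coe_sort S, Finset.smul_sum]
      exact Finset.sum_congr rfl fun ξ _ => by rw [smul_smul]
    rw [setIntegral_congr_fun measurableSet_cell h1, integral_finsetSum]
    · rw [interp_eq_sum hR u (r := ‖x₀‖ + d) (by simp), ← hS, ← Finset.sum_coe_sort S]
      refine Finset.sum_congr rfl fun ξ _ => ?_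
      rw [integral_smul_const, ← hval ξ]
      simp [hf]
    · exact fun ξ _ => (hint _ (by fun_prop)).smul_const _

/-- The weight `g` does not depend on `u`, so by translation the same weight represents the value at
every `x₀ + site ξ`. -/
lemma latticeNorm_interp_le {θ : EuclideanSpace ℝ (Fin d) → ℝ} (hc : Continuous θ)
    (hs : HasCompactSupport θ) (x₀ : EuclideanSpace ℝ (Fin d)) : ∃ C : ℝ≥0, 0 < C ∧
      ∀ (u : (Fin d → ℤ) → EuclideanSpace ℝ (Fin m)) (p : ℝ≥0∞), 1 ≤ p →
        latticeNorm p (fun ξ => interp θ u (x₀ + site ξ)) ≤ C * eLpNorm (interp θ u) p volume := by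
  obtain ⟨g, ⟨M, hM⟩, hg⟩ := exists_interp_eq_setIntegral_cell (m := m) hc hs x₀
  obtain ⟨K, hK, hgK⟩ : ∃ K : ℝ≥0, 0 < K ∧ ∀ y, ‖g y‖ₑ ≤ K := by
    refine ⟨M.toNNReal + 1, by positivity, fun y => ?_⟩
    rw [enorm_eq_nnnorm, ENNReal.coe_le_coe]
    refine le_trans ?_ le_self_add
    rw [← NNReal.coe_le_coe]
    exact (hM y).trans (Real.le_coe_toNNReal M)
  refine ⟨K, hK, fun u p hp => ?_⟩
  have hcont := continuous_interp hc hs u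
  have h1 : eLpNorm (fun x => interp θ u (x + x₀)) p volume = eLpNorm (interp θ u) p volume :=
    eLpNorm_comp_measurePreserving (g := interp θ u) hcont.aestronglyMeasurable (measurePreserving_add_right volume x₀)
  have h2 : StronglyMeasurable fun x => interp θ u (x + x₀) :=
    (hcont.comp (continuous_add_const x₀)).stronglyMeasurable
  have h3 : ∀ ξ, ‖interp θ u (x₀ + site ξ)‖ₑ ≤
      K * ∫⁻ y in cell d, ‖interp θ u (y + site ξ + x₀)‖ₑ := fun ξ => by
    rw [interp_add_site, hg]
    refine (enorm_integral_le_lintegral_enorm _).trans ?_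
    rw [← lintegral_const_mul' _ _ ENNReal.coe_ne_top]
    refine lintegral_mono fun y => ?_
    rw [← interp_add_site, enorm_smul, show x₀ + y + site ξ = y + site ξ + x₀ by abel]
    exact mul_le_mul_left (hgK y) _
  rw [← h1]
  exact eLpNorm_count_le_of_cell_average h2 _ h3 hp

/-! ### Convolution with the nodal basis function -/

/-- The convolution of two real functions, in the form used for the quasi-interpolant. -/
def mollify (ζ k : EuclideanSpace ℝ (Fin d) → ℝ) (x : EuclideanSpace ℝ (Fin d)) : ℝ :=
  ∫ y, ζ (x - y) * k y

lemma mollify_eq_convolution (ζ k : EuclideanSpace ℝ (Fin d) → ℝ) :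
    mollify ζ k = convolution k ζ (ContinuousLinearMap.mul ℝ ℝ) volume := by
  ext x
  simp [mollify, convolution, mul_comm]

lemma continuous_mollify {ζ k : EuclideanSpace ℝ (Fin d) → ℝ} (hc : Continuous ζ)
    (hs : HasCompactSupport ζ) (hk : Integrable k) : Continuous (mollify ζ k) := by
  rw [mollify_eq_convolution]
  exact hs.continuous_convolution_right _ hk.locallyIntegrable hc

lemma mollify_eq_zero {ζ k : EuclideanSpace ℝ (Fin d) → ℝ} {R r : ℝ}
    (hR : ∀ x, R < ‖x‖ → ζ x = 0) (hr : ∀ x, r < ‖x‖ → k x = 0) {x : EuclideanSpace ℝ (Fin d)}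
    (hx : r + R < ‖x‖) : mollify ζ k x = 0 := by
  refine integral_eq_zero_of_ae (Filter.Eventually.of_forall fun y => ?_)
  rcases lt_or_ge r ‖y‖ with h | h
  · simp [hr y h]
  · have := norm_sub_norm_le x y
    simp [hR (x - y) (by linarith)]

lemma hasCompactSupport_of_forall_norm_lt {F : Type*} [Zero F]
    {f : EuclideanSpace ℝ (Fin d) → F} {R : ℝ} (hR : ∀ x, R < ‖x‖ → f x = 0) :
    HasCompactSupport f :=
  HasCompactSupport.intro (isCompact_closedBall 0 R) fun x hx =>
    hR x (by simpa using hx)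

lemma integrable_mollify {ζ k : EuclideanSpace ℝ (Fin d) → ℝ} (hζ : Integrable ζ)
    (hk : Integrable k) : Integrable (mollify ζ k) := by
  rw [mollify_eq_convolution]
  exact hk.integrable_convolution _ hζ

lemma integrable_mul_of_continuous {ζ k : EuclideanSpace ℝ (Fin d) → ℝ} (hc : Continuous ζ)
    (hs : HasCompactSupport ζ) (hk : Integrable k) (x : EuclideanSpace ℝ (Fin d)) :
    Integrable fun y => ζ (x - y) * k y := by
  obtain ⟨M, hM⟩ := hs.exists_bound_of_continuous hc
  exact hk.bdd_mul (c := M) (by fun_prop) (Filter.Eventually.of_forall fun y => hM _)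

/-- Mollification of an interpolant amounts to mollification of the basis function. -/
lemma integral_smul_interp {ζ k : EuclideanSpace ℝ (Fin d) → ℝ} (hc : Continuous ζ)
    (hs : HasCompactSupport ζ) (hk : Integrable k) (hks : HasCompactSupport k)
    (u : (Fin d → ℤ) → EuclideanSpace ℝ (Fin m)) (x : EuclideanSpace ℝ (Fin d)) :
    ∫ y, ζ (x - y) • interp k u y = interp (mollify ζ k) u x := by
  obtain ⟨R, -, hR⟩ := hs.exists_forall_norm_lt_eq_zero
  obtain ⟨r, -, hr⟩ := hks.exists_forall_norm_lt_eq_zero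
  have h1 : ∀ y, ζ (x - y) • interp k u y
      = ∑ ξ ∈ latticeBall d (r + (R + ‖x‖)), (ζ (x - y) * k (y - site ξ)) • u ξ := fun y => by
    rcases lt_or_ge R ‖x - y‖ with h | h
    · simp [hR _ h]
    · have h2 := norm_sub_norm_le y x
      rw [norm_sub_rev] at h2
      rw [interp_eq_sum hr u (r := R + ‖x‖) (by linarith), Finset.smul_sum]
      simp only [smul_smul]
  simp only [h1]
  rw [integral_finsetSum, interp_eq_sum (fun y hy => mollify_eq_zero hR hr hy) u le_rfl]
  · rw [← add_assoc]
    refine Finset.sum_congr rfl fun ξ _ => ?_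
    rw [integral_smul_const]
    congr 1
    rw [mollify, ← integral_add_right_eq_self _ (site ξ)]
    simp [sub_add_eq_sub_sub_swap]
  · intro ξ _
    refine (integrable_mul_of_continuous hc hs (hk.comp_sub_right (site ξ)) x).smul_const _

lemma IsNodalBasis.quasiInterp_eq {ζ : EuclideanSpace ℝ (Fin d) → ℝ} (hζ : IsNodalBasis ζ)
    (u : (Fin d → ℤ) → EuclideanSpace ℝ (Fin m)) :
    quasiInterp ζ u = interp (mollify ζ ζ) u := by
  ext1 x
  exact integral_smul_interp hζ.continuous hζ.hasCompactSupport hζ.integrable hζ.hasCompactSupport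
    u x

lemma IsNodalBasis.continuous_mollify {ζ : EuclideanSpace ℝ (Fin d) → ℝ} (hζ : IsNodalBasis ζ) :
    Continuous (mollify ζ ζ) :=
  LatticeInterp.continuous_mollify hζ.continuous hζ.hasCompactSupport hζ.integrable

lemma hasCompactSupport_mollify {ζ k : EuclideanSpace ℝ (Fin d) → ℝ} (hs : HasCompactSupport ζ)
    (hk : HasCompactSupport k) : HasCompactSupport (mollify ζ k) := by
  obtain ⟨R, -, hR⟩ := hs.exists_forall_norm_lt_eq_zero
  obtain ⟨r, -, hr⟩ := hk.exists_forall_norm_lt_eq_zero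
  exact hasCompactSupport_of_forall_norm_lt fun x hx => mollify_eq_zero hR hr hx

/-! ### The action of the group algebra of the lattice -/

/-- The group algebra of `ℤ^d` acts on lattice functions: the group element `κ` acts as the shift
by `κ`. -/
def shiftAction (d m : ℕ) : AddMonoidAlgebra ℝ (Fin d → ℤ) →ₐ[ℝ]
    Module.End ℝ ((Fin d → ℤ) → EuclideanSpace ℝ (Fin m)) :=
  AddMonoidAlgebra.lift ℝ _ _
    { toFun := fun κ => LinearMap.funLeft ℝ _ fun ξ => ξ - κ.toAdd
      map_one' := by ext u ξ; simp [LinearMap.funLeft_apply]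
      map_mul' := fun κ η => by
        ext u ξ : 2
        simp [LinearMap.funLeft_apply, sub_sub] }

lemma shiftAction_apply (f : AddMonoidAlgebra ℝ (Fin d → ℤ))
    (u : (Fin d → ℤ) → EuclideanSpace ℝ (Fin m)) (ξ : Fin d → ℤ) :
    shiftAction d m f u ξ = ∑ κ ∈ f.coeff.support, f.coeff κ • u (ξ - κ) := by
  rw [shiftAction, AddMonoidAlgebra.lift_apply, Finsupp.sum, LinearMap.sum_apply, Finset.sum_apply]
  rfl

lemma shiftAction_single (κ : Fin d → ℤ) (c : ℝ)
    (u : (Fin d → ℤ) → EuclideanSpace ℝ (Fin m)) (ξ : Fin d → ℤ) :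
    shiftAction d m (.single κ c) u ξ = c • u (ξ - κ) := by
  rw [shiftAction, AddMonoidAlgebra.lift_single]
  rfl

lemma latticeNorm_shiftAction_le (f : AddMonoidAlgebra ℝ (Fin d → ℤ))
    (u : (Fin d → ℤ) → EuclideanSpace ℝ (Fin m)) {p : ℝ≥0∞} (hp : 1 ≤ p) :
    latticeNorm p (shiftAction d m f u) ≤
      (∑ κ ∈ f.coeff.support, ‖f.coeff κ‖₊ : ℝ≥0) * latticeNorm p u := by
  have h1 : shiftAction d m f u = ∑ κ ∈ f.coeff.support, f.coeff κ • fun ξ => u (ξ - κ) := by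
    ext1 ξ
    simp [shiftAction_apply]
  rw [h1]
  refine (eLpNorm_sum_le (fun κ _ => .of_discrete) hp).trans ?_
  push_cast
  rw [Finset.sum_mul]
  refine Finset.sum_le_sum fun κ _ => ?_
  rw [eLpNorm_const_smul, enorm_eq_nnnorm]
  gcongr
  simpa [sub_eq_add_neg, latticeNorm] using (latticeNorm_add_right p u (-κ)).le

/-- The element of the group algebra with coefficients `θ (x + κ)`, `κ` in a finite set of sites. -/
def sampling (θ : EuclideanSpace ℝ (Fin d) → ℝ) (S : Finset (Fin d → ℤ))
    (x : EuclideanSpace ℝ (Fin d)) : AddMonoidAlgebra ℝ (Fin d → ℤ) :=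
  ∑ κ ∈ S, .single κ (θ (x + site κ))

/-- The coefficient `θ (x + site κ)` multiplies `u (ξ - κ)`; replacing `κ` by `-κ`, which preserves
the ball, gives the interpolation sum. Sampling on a shifted lattice thus becomes multiplication in
a commutative ring. -/
lemma shiftAction_sampling {θ : EuclideanSpace ℝ (Fin d) → ℝ} {R : ℝ}
    (hR : ∀ x, R < ‖x‖ → θ x = 0) (x : EuclideanSpace ℝ (Fin d))
    (u : (Fin d → ℤ) → EuclideanSpace ℝ (Fin m)) (ξ : Fin d → ℤ) :
    shiftAction d m (sampling θ (latticeBall d (R + ‖x‖)) x) u ξ = interp θ u (x + site ξ) := by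
  rw [sampling, map_sum, LinearMap.sum_apply, Finset.sum_apply, interp_add_site,
    interp_eq_sum hR _ le_rfl, ← sum_latticeBall_neg]
  refine Finset.sum_congr rfl fun κ _ => ?_
  rw [shiftAction_single, site_neg, ← sub_eq_add_neg, sub_neg_eq_add, add_comm ξ]

/-! ### Fourier coefficients of lattice-periodic functions -/

/-- The projection of `ℝ^d` onto the torus `ℝ^d / ℤ^d`. -/
def toTorus (x : EuclideanSpace ℝ (Fin d)) : UnitAddTorus (Fin d) := fun i => (x i : UnitAddCircle)

lemma continuous_toTorus : Continuous (toTorus (d := d)) :=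
  continuous_pi fun i => (AddCircle.continuous_mk' 1).comp (by fun_prop)

lemma toTorus_add (x y : EuclideanSpace ℝ (Fin d)) : toTorus (x + y) = toTorus x + toTorus y := by
  ext i; simp [toTorus]

lemma toTorus_site (ξ : Fin d → ℤ) : toTorus (site ξ) = 0 := by
  ext i
  simp only [toTorus, site_apply, Pi.zero_apply]
  exact (AddCircle.coe_eq_zero_iff 1).2 ⟨ξ i, by simp⟩

lemma exists_eq_add_site_of_toTorus_eq {x y : EuclideanSpace ℝ (Fin d)}
    (h : toTorus x = toTorus y) : ∃ ξ, x = y + site ξ := by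
  have : ∀ i, ∃ n : ℤ, n • (1 : ℝ) = x i - y i := fun i => by
    rw [← AddCircle.coe_eq_zero_iff, AddCircle.coe_sub, sub_eq_zero]
    exact congrFun h i
  choose n hn using this
  refine ⟨n, ?_⟩
  ext i
  have := hn i
  simp only [zsmul_eq_mul, mul_one] at this
  simp [this]

lemma mFourier_add_right (n : Fin d → ℤ) (x y : UnitAddTorus (Fin d)) :
    UnitAddTorus.mFourier n (x + y) = UnitAddTorus.mFourier n x * UnitAddTorus.mFourier n y := by
  simp only [UnitAddTorus.mFourier, ContinuousMap.coe_mk, Pi.add_apply, ← Finset.prod_mul_distrib]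
  refine Finset.prod_congr rfl fun i _ => ?_
  simp [fourier_apply, smul_add, AddCircle.toCircle_add]

lemma mFourier_zero_right (n : Fin d → ℤ) : UnitAddTorus.mFourier n 0 = 1 := by
  simp [UnitAddTorus.mFourier]

/-- The function descends to a continuous function on the torus. All its Fourier coefficients
vanish, hence are summable, so its Fourier series converges to it at every point, with sum zero. -/
lemma eq_zero_of_periodic_of_fourier_eq_zero {w : EuclideanSpace ℝ (Fin d) → ℂ}
    (hw : Continuous w) (hper : ∀ x ξ, w (x + site ξ) = w x)
    (h : ∀ n, ∫ x in cell d, UnitAddTorus.mFourier n (toTorus x) * w x = 0) : w = 0 := by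
  have hq : Topology.IsQuotientMap (Pi.map fun _ (t : ℝ) => (t : UnitAddCircle) :
      (Fin d → ℝ) → UnitAddTorus (Fin d)) :=
    (IsOpenQuotientMap.piMap fun _ => QuotientAddGroup.isOpenQuotientMap_mk).isQuotientMap
  have hlift : ∀ a b : Fin d → ℝ, (Pi.map fun _ (t : ℝ) => (t : UnitAddCircle)) a =
      (Pi.map fun _ (t : ℝ) => (t : UnitAddCircle)) b → w (WithLp.toLp 2 a) = w (WithLp.toLp 2 b) := by
    intro a b hab
    obtain ⟨ξ, hξ⟩ := exists_eq_add_site_of_toTorus_eq (x := WithLp.toLp 2 a) (y := WithLp.toLp 2 b)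
      hab
    rw [hξ, hper]
  let W : C(UnitAddTorus (Fin d), ℂ) := Topology.IsQuotientMap.lift
    (f := ⟨_, hq.continuous⟩) hq ⟨fun a => w (WithLp.toLp 2 a), by fun_prop⟩ hlift
  have hW : ∀ a : Fin d → ℝ, W (fun i => (a i : UnitAddCircle)) = w (WithLp.toLp 2 a) := fun a =>
    DFunLike.congr_fun (Topology.IsQuotientMap.lift_comp (f := ⟨_, hq.continuous⟩) hq
      ⟨fun a => w (WithLp.toLp 2 a), by fun_prop⟩ hlift) a
  have hcoef : UnitAddTorus.mFourierCoeff W = 0 := by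
    ext n
    rw [UnitAddTorus.mFourierCoeff_eq_integral _ _ fun _ => -(1 / 2), Pi.zero_apply, ← h (-n),
      ← (PiLp.volume_preserving_ofLp (Fin d)).setIntegral_preimage_emb
        (MeasurableEquiv.measurableEmbedding (MeasurableEquiv.toLp 2 (Fin d → ℝ)).symm)]
    have : (WithLp.ofLp ⁻¹' {x : Fin d → ℝ | ∀ i, x i ∈ Set.Ioc (-(1 / 2) : ℝ) (-(1 / 2) + 1)}) =
        cell d := by
      ext x
      rw [mem_cell]
      norm_num
    rw [this]
    refine setIntegral_congr_fun measurableSet_cell fun x _ => ?_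
    simp only [hW, smul_eq_mul]
    rfl
  ext x
  have hs : Summable (UnitAddTorus.mFourierCoeff W) := by rw [hcoef]; exact summable_zero
  have := UnitAddTorus.hasSum_mFourier_series_apply_of_summable hs (toTorus x)
  simp only [hcoef, Pi.zero_apply, zero_smul] at this
  exact (hW x.ofLp).symm.trans (this.unique hasSum_zero)

lemma continuous_sum_translates {g : EuclideanSpace ℝ (Fin d) → ℂ} (hg : Continuous g) {R : ℝ}
    (hR : ∀ x, R < ‖x‖ → g x = 0) : Continuous fun x => ∑' ξ : Fin d → ℤ, g (x + site ξ) := by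
  refine continuous_iff_continuousAt.2 fun x => ?_
  have h : ContinuousAt (fun y => ∑ ξ ∈ latticeBall d (R + (‖x‖ + 1)), g (y + site ξ)) x :=
    Continuous.continuousAt (by fun_prop)
  refine h.congr ?_
  filter_upwards [Metric.ball_mem_nhds x one_pos] with y hy
  refine (tsum_eq_sum fun ξ hξ => hR _ ?_).symm
  rw [Metric.mem_ball, dist_eq_norm] at hy
  have h1 := norm_le_norm_add_norm_sub x y
  have h2 := norm_sub_le (y + site ξ) y
  rw [add_sub_cancel_left] at h2
  rw [norm_sub_rev] at h1
  simp only [mem_latticeBall, not_le] at hξ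
  linarith

/-- If the periodization of `g * g` vanishes, then so does the periodization of `g`. -/
lemma tsum_translates_eq_zero {g : EuclideanSpace ℝ (Fin d) → ℂ} (hg : Continuous g) {R : ℝ}
    (hR : ∀ x, R < ‖x‖ → g x = 0)
    (h : ∀ x ∈ cell d, ∑ ξ ∈ latticeBall d (R + R + d), ∫ y, g (x + site ξ - y) * g y = 0)
    (x : EuclideanSpace ℝ (Fin d)) : ∑' ξ : Fin d → ℤ, g (x + site ξ) = 0 := by
  refine congrFun (eq_zero_of_periodic_of_fourier_eq_zero (continuous_sum_translates hg hR)
    (fun x ξ => ?_) fun n => ?_) x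
  · rw [← (Equiv.addLeft ξ).tsum_eq fun η => g (x + site η)]
    exact tsum_congr fun η => by simp [site_add, add_assoc]
  -- Since `e` is multiplicative and trivial on the lattice, twisting `g` by `e` commutes both with
  -- convolution and with periodization.
  set e : EuclideanSpace ℝ (Fin d) → ℂ := fun x => UnitAddTorus.mFourier n (toTorus x) with he
  have hec : Continuous e := (UnitAddTorus.mFourier n).continuous.comp continuous_toTorus
  have hea : ∀ x y, e (x + y) = e x * e y := fun x y => by
    simp only [he, toTorus_add, mFourier_add_right]
  have hes : ∀ ξ, e (site ξ) = 1 := fun ξ => by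
    simp only [he, toTorus_site, mFourier_zero_right]
  set k : EuclideanSpace ℝ (Fin d) → ℂ := fun x => e x * g x with hk
  have hkR : ∀ x, R < ‖x‖ → k x = 0 := fun x hx => by simp [hk, hR x hx]
  have hki : Integrable k := (hec.mul hg).integrable_of_hasCompactSupport
    (hasCompactSupport_of_forall_norm_lt hkR)
  have hkk : ∀ x, ∫ y, k y * k (x - y) = e x * ∫ y, g (x - y) * g y := fun x => by
    rw [← integral_const_mul]
    refine integral_congr_ae (Filter.Eventually.of_forall fun y => ?_)
    have : e x = e y * e (x - y) := by rw [← hea, add_sub_cancel]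
    simp only [hk, this]
    ring
  -- The integral of `k * k` is the square of that of `k`. Unfolded on the cell it is a Fourier
  -- coefficient of the periodization of `g * g`, hence zero; the integral of `k` unfolds to the
  -- coefficient sought.
  have h1 : ∫ x, ∫ y, k y * k (x - y) = (∫ x, k x) * ∫ x, k x := by
    simpa [convolution] using integral_convolution (ContinuousLinearMap.mul ℝ ℂ) hki hki (μ := volume)
  have h2 : ∫ x, ∫ y, k y * k (x - y) = 0 := by
    rw [integral_eq_setIntegral_cell_sum (R := R + R)]
    · refine setIntegral_eq_zero_of_forall_eq_zero fun x hx => ?_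
      simp only [hkk, hea, hes, mul_one]
      rw [← Finset.mul_sum, h x hx, mul_zero]
    · exact hki.integrable_convolution (ContinuousLinearMap.mul ℝ ℂ) hki
    · intro x hx
      refine integral_eq_zero_of_ae (Filter.Eventually.of_forall fun y => ?_)
      rcases lt_or_ge R ‖y‖ with hy | hy
      · simp [hkR y hy]
      · have := norm_sub_norm_le x y
        simp [hkR (x - y) (by linarith)]
  have h3 : ∫ x, k x = 0 := by
    rw [h1] at h2
    exact mul_self_eq_zero.1 h2
  rw [← h3, integral_eq_setIntegral_cell_sum hki hkR]
  refine setIntegral_congr_fun measurableSet_cell fun x hx => ?_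
  have h4 : ∑' ξ : Fin d → ℤ, g (x + site ξ) = ∑ ξ ∈ latticeBall d (R + d), g (x + site ξ) := by
    refine tsum_eq_sum fun ξ hξ => hR _ ?_
    have h2 := norm_sub_le (x + site ξ) x
    rw [add_sub_cancel_left] at h2
    simp only [mem_latticeBall, not_le] at hξ
    linarith [norm_le_of_mem_cell hx]
  simp only [h4, hk, hea, hes, mul_one]
  rw [Finset.mul_sum]

/-! ### The ideal generated by the samples of the mollified basis function -/

/-- The weak Nullstellensatz: the residue field of a maximal ideal of a finitely generated real
algebra is finite over `ℝ`, so it embeds in `ℂ` and yields a character killing the ideal. -/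
lemma eq_top_of_forall_algHom {A : Type*} [AddCommMonoid A] [AddMonoid.FG A]
    (I : Ideal (AddMonoidAlgebra ℝ A))
    (h : ∀ χ : AddMonoidAlgebra ℝ A →ₐ[ℝ] ℂ, ∃ f ∈ I, χ f ≠ 0) : I = ⊤ := by
  by_contra hI
  obtain ⟨M, hM, hIM⟩ := Ideal.exists_le_maximal I hI
  let : Field (AddMonoidAlgebra ℝ A ⧸ M) := Ideal.Quotient.field M
  have : Module.Finite ℝ (AddMonoidAlgebra ℝ A ⧸ M) := finite_of_finite_type_of_isJacobsonRing _ _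
  have : Algebra.IsAlgebraic ℝ (AddMonoidAlgebra ℝ A ⧸ M) := Algebra.IsAlgebraic.of_finite _ _
  let ι : (AddMonoidAlgebra ℝ A ⧸ M) →ₐ[ℝ] ℂ := IsAlgClosed.lift
  obtain ⟨f, hf, hχ⟩ := h (ι.comp (Ideal.Quotient.mkₐ ℝ M))
  refine hχ ?_
  simp [Ideal.Quotient.eq_zero_iff_mem.2 (hIM hf)]

/-- A complex character of `ℤ^d` extends to a continuous character of `ℝ^d`. -/
lemma exists_character_extension (χ : AddMonoidAlgebra ℝ (Fin d → ℤ) →ₐ[ℝ] ℂ) :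
    ∃ e : EuclideanSpace ℝ (Fin d) → ℂ, Continuous e ∧ e 0 = 1 ∧ (∀ x y, e (x + y) = e x * e y) ∧
      ∀ κ, e (site κ) = χ (.single κ 1) := by
  have hmul : ∀ κ η : Fin d → ℤ, χ (.single (κ + η) 1) = χ (.single κ 1) * χ (.single η 1) :=
    fun κ η => by rw [← map_mul, AddMonoidAlgebra.single_mul_single, one_mul]
  have hone : χ (.single 0 1) = 1 := by rw [← AddMonoidAlgebra.one_def, map_one]
  have hz : ∀ i, χ (.single (Pi.single i 1) 1) ≠ 0 := fun i h0 => by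
    have := hmul (Pi.single i 1) (-Pi.single i 1)
    rw [add_neg_cancel, hone, h0, zero_mul] at this
    exact one_ne_zero this
  -- Any logarithms of the values on the generators will do. The character need not be unitary, so
  -- `e` may grow exponentially; this is harmless as it only multiplies functions of compact
  -- support.
  let l : Fin d → ℂ := fun i => Complex.log (χ (.single (Pi.single i 1) 1))
  let e : EuclideanSpace ℝ (Fin d) → ℂ := fun x => Complex.exp (∑ i, (x i : ℂ) * l i)
  have hea : ∀ x y, e (x + y) = e x * e y := fun x y => by
    simp only [e, PiLp.add_apply, Complex.ofReal_add, add_mul, Finset.sum_add_distrib,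
      Complex.exp_add]
  refine ⟨e, by fun_prop, by simp [e], hea, fun κ => ?_⟩
  let F : (Fin d → ℤ) →+ Additive ℂ :=
    { toFun := fun κ => Additive.ofMul (e (site κ))
      map_zero' := by simp [e]
      map_add' := fun κ η => by rw [site_add, hea, ofMul_mul] }
  let G : (Fin d → ℤ) →+ Additive ℂ :=
    { toFun := fun κ => Additive.ofMul (χ (.single κ 1))
      map_zero' := by rw [hone, ofMul_one]
      map_add' := fun κ η => by rw [hmul, ofMul_mul] }
  have hFG : F = G := by
    ext i
    change e (site (Pi.single i 1)) = χ (.single (Pi.single i 1) 1)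
    have : ∑ j, ((site (Pi.single i 1) : EuclideanSpace ℝ (Fin d)) j : ℂ) * l j = l i := by
      rw [Finset.sum_eq_single i]
      · simp
      · intro j _ hj; simp [Pi.single_eq_of_ne hj]
      · simp
    simp only [e, this, l, Complex.exp_log (hz i)]
  exact DFunLike.congr_fun hFG κ

/-- A character killing all samples of `ζ * ζ` would make the periodization of `g * g` vanish, where
`g = e ζ`. Hence that of `g` vanishes, whereas at the origin only the term `ζ 0 = 1` survives. -/
lemma IsNodalBasis.span_sampling_mollify {ζ : EuclideanSpace ℝ (Fin d) → ℝ} (hζ : IsNodalBasis ζ)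
    {R : ℝ} (hR : ∀ x, R < ‖x‖ → ζ x = 0) :
    Ideal.span (Set.range fun x : EuclideanSpace ℝ (Fin d) =>
      sampling (mollify ζ ζ) (latticeBall d (R + R + ‖x‖)) x) = ⊤ := by
  refine eq_top_of_forall_algHom _ fun χ => ?_
  by_contra! hχ
  have h0 : ∀ x, χ (sampling (mollify ζ ζ) (latticeBall d (R + R + ‖x‖)) x) = 0 := fun x =>
    hχ _ (Ideal.subset_span ⟨x, rfl⟩)
  obtain ⟨e, hec, he0, hea, hes⟩ := exists_character_extension χ
  set g : EuclideanSpace ℝ (Fin d) → ℂ := fun x => e x * ζ x with hg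
  have hgc : Continuous g := hec.mul (Complex.continuous_ofReal.comp hζ.continuous)
  have hgR : ∀ x, R < ‖x‖ → g x = 0 := fun x hx => by simp [hg, hR x hx]
  have hgg : ∀ x, ∫ y, g (x - y) * g y = e x * (mollify ζ ζ x : ℂ) := fun x => by
    rw [mollify, ← integral_complex_ofReal, ← integral_const_mul]
    refine integral_congr_ae (Filter.Eventually.of_forall fun y => ?_)
    have : e x = e (x - y) * e y := by rw [← hea, sub_add_cancel]
    simp only [hg, this]
    push_cast
    ring
  have key := tsum_translates_eq_zero hgc hgR (fun x hx => ?_) 0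
  · rw [tsum_eq_single 0 fun ξ hξ => by simp [hg, hζ.at_site ξ hξ]] at key
    simp [hg, he0, hζ.at_zero] at key
  · have h1 := h0 x
    rw [sampling, map_sum] at h1
    have h2 : ∀ κ, χ (.single κ (mollify ζ ζ (x + site κ))) =
        e (site κ) * (mollify ζ ζ (x + site κ) : ℂ) := fun κ => by
      rw [hes, mul_comm, ← Complex.real_smul, ← map_smul, AddMonoidAlgebra.smul_single, smul_eq_mul,
        mul_one]
    simp only [h2] at h1
    simp only [hgg, hea, mul_assoc]
    rw [← Finset.mul_sum]
    refine mul_eq_zero_of_right _ ?_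
    rw [← h1]
    symm
    -- The two lattice balls, of radii `R + R + ‖x‖` and `R + R + d`, differ only by sites where `ζ
    -- * ζ` is zero.
    refine Finset.sum_subset (fun κ hκ => ?_) fun κ _ hκ => ?_
    · simp only [mem_latticeBall] at hκ ⊢
      linarith [norm_le_of_mem_cell hx]
    · rw [mollify_eq_zero hR hR, Complex.ofReal_zero, mul_zero]
      have h2 := norm_sub_le (x + site κ) x
      rw [add_sub_cancel_left] at h2
      simp only [mem_latticeBall, not_le] at hκ
      linarith

/-- Stability: the lattice function is controlled by its quasi-interpolant. -/
lemma IsNodalBasis.latticeNorm_le_eLpNorm_quasiInterp {ζ : EuclideanSpace ℝ (Fin d) → ℝ}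
    (hζ : IsNodalBasis ζ) : ∃ C : ℝ≥0, 0 < C ∧
      ∀ (u : (Fin d → ℤ) → EuclideanSpace ℝ (Fin m)) (p : ℝ≥0∞), 1 ≤ p →
        latticeNorm p u ≤ C * eLpNorm (quasiInterp ζ u) p volume := by
  obtain ⟨R, -, hR⟩ := hζ.hasCompactSupport'
  have h1 := hζ.span_sampling_mollify hR
  -- Membership of `1` in the ideal gives a finite Bézout identity; its coefficients `Q x` act with
  -- finite `ℓ¹` norm, uniformly in `p` and `u`.
  rw [Ideal.eq_top_iff_one, Ideal.span, Finsupp.mem_span_range_iff_exists_finsupp] at h1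
  obtain ⟨Q, hQ⟩ := h1
  have hloc := fun x => latticeNorm_interp_le (m := m) hζ.continuous_mollify
    (hasCompactSupport_mollify hζ.hasCompactSupport hζ.hasCompactSupport) x
  choose K hK hloc using hloc
  refine ⟨∑ x ∈ Q.support, (∑ κ ∈ (Q x).coeff.support, ‖(Q x).coeff κ‖₊) * K x + 1, by positivity,
    fun u p hp => ?_⟩
  have hu : u = ∑ x ∈ Q.support,
      shiftAction d m (Q x) (fun ξ => interp (mollify ζ ζ) u (x + site ξ)) := by
    conv_lhs => rw [← Module.End.one_apply (R := ℝ) u, ← map_one (shiftAction d m), ← hQ]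
    rw [Finsupp.sum, map_sum, LinearMap.sum_apply]
    refine Finset.sum_congr rfl fun x _ => ?_
    rw [smul_eq_mul, map_mul, Module.End.mul_apply]
    congr 1
    ext1 ξ
    exact shiftAction_sampling (fun y hy => mollify_eq_zero hR hR hy) x u ξ
  calc latticeNorm p u = latticeNorm p (∑ x ∈ Q.support,
      shiftAction d m (Q x) (fun ξ => interp (mollify ζ ζ) u (x + site ξ))) := by rw [← hu]
    _ ≤ ∑ x ∈ Q.support, latticeNorm p
      (shiftAction d m (Q x) (fun ξ => interp (mollify ζ ζ) u (x + site ξ))) :=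
        eLpNorm_sum_le (fun _ _ => .of_discrete) hp
    _ ≤ ∑ x ∈ Q.support, (∑ κ ∈ (Q x).coeff.support, ‖(Q x).coeff κ‖₊ : ℝ≥0) *
          (K x * eLpNorm (quasiInterp ζ u) p volume) := by
        refine Finset.sum_le_sum fun x _ => (latticeNorm_shiftAction_le _ _ hp).trans ?_
        gcongr
        rw [hζ.quasiInterp_eq]
        exact hloc x u p hp
    _ ≤ _ := by
        simp only [← mul_assoc]
        rw [← Finset.sum_mul]
        gcongr
        push_cast
        exact le_self_add

/-! ### The Gram operator of the translates of the basis function -/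

/-- The standard bilinear form on the group algebra of `ℤ^d`. -/
def coeffDot (d : ℕ) : LinearMap.BilinForm ℝ (AddMonoidAlgebra ℝ (Fin d → ℤ)) :=
  (Finsupp.linearCombination ℝ fun κ : Fin d → ℤ =>
    (Finsupp.lapply κ : ((Fin d → ℤ) →₀ ℝ) →ₗ[ℝ] ℝ) ∘ₗ
      (AddMonoidAlgebra.coeffLinearEquiv ℝ).toLinearMap) ∘ₗ
    (AddMonoidAlgebra.coeffLinearEquiv ℝ).toLinearMap

lemma coeffDot_apply (f g : AddMonoidAlgebra ℝ (Fin d → ℤ)) :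
    coeffDot d f g = ∑ κ ∈ f.coeff.support, f.coeff κ * g.coeff κ := by
  rw [coeffDot, LinearMap.comp_apply, Finsupp.linearCombination_apply, Finsupp.sum,
    LinearMap.sum_apply]
  rfl

lemma coeffDot_comm (f g : AddMonoidAlgebra ℝ (Fin d → ℤ)) : coeffDot d f g = coeffDot d g f := by
  classical
  rw [coeffDot_apply, coeffDot_apply]
  rw [Finset.sum_subset (s₂ := f.coeff.support ∪ g.coeff.support) Finset.subset_union_left
    fun κ _ h => by rw [Finsupp.notMem_support_iff.1 h, zero_mul],
    Finset.sum_subset (s₁ := g.coeff.support) (s₂ := f.coeff.support ∪ g.coeff.support)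
      Finset.subset_union_right fun κ _ h => by rw [Finsupp.notMem_support_iff.1 h, zero_mul]]
  exact Finset.sum_congr rfl fun κ _ => mul_comm _ _

lemma coeffDot_self (f : AddMonoidAlgebra ℝ (Fin d → ℤ)) :
    coeffDot d f f = ∑ κ ∈ f.coeff.support, f.coeff κ ^ 2 := by
  simp only [coeffDot_apply, sq]

lemma coeffDot_self_nonneg (f : AddMonoidAlgebra ℝ (Fin d → ℤ)) : 0 ≤ coeffDot d f f := by
  rw [coeffDot_self]
  exact Finset.sum_nonneg fun κ _ => sq_nonneg _

lemma coeff_sq_le_coeffDot (f : AddMonoidAlgebra ℝ (Fin d → ℤ)) (κ : Fin d → ℤ) :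
    f.coeff κ ^ 2 ≤ coeffDot d f f := by
  by_cases h : κ ∈ f.coeff.support
  · rw [coeffDot_self]
    exact Finset.single_le_sum (f := fun κ => f.coeff κ ^ 2) (fun _ _ => sq_nonneg _) h
  · rw [Finsupp.notMem_support_iff.1 h]
    simpa using coeffDot_self_nonneg f

lemma coeffDot_one : coeffDot d 1 1 = 1 := by
  rw [coeffDot_self, AddMonoidAlgebra.one_def, AddMonoidAlgebra.coeff_single,
    Finsupp.support_single _ one_ne_zero]
  simp

/-- The function `∑ f(κ) ζ(· - κ)`. -/
def synth (ζ : EuclideanSpace ℝ (Fin d) → ℝ) (f : AddMonoidAlgebra ℝ (Fin d → ℤ))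
    (x : EuclideanSpace ℝ (Fin d)) : ℝ :=
  ∑ κ ∈ f.coeff.support, f.coeff κ * ζ (x - site κ)

lemma interp_coeff (ζ : EuclideanSpace ℝ (Fin d) → ℝ) (f : AddMonoidAlgebra ℝ (Fin d → ℤ))
    (x : EuclideanSpace ℝ (Fin d)) :
    interp ζ (fun κ => EuclideanSpace.single (0 : Fin 1) (f.coeff κ)) x =
      EuclideanSpace.single 0 (synth ζ f x) := by
  rw [interp, tsum_eq_sum (s := f.coeff.support)
    fun κ h => by rw [Finsupp.notMem_support_iff.1 h]; simp]
  ext i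
  fin_cases i
  simp [synth, mul_comm]

lemma latticeNorm_two_sq (f : AddMonoidAlgebra ℝ (Fin d → ℤ)) :
    latticeNorm 2 (fun κ => EuclideanSpace.single (0 : Fin 1) (f.coeff κ)) ^ 2 =
      ENNReal.ofReal (coeffDot d f f) := by
  have h := eLpNorm_nnreal_pow_eq_lintegral (p := 2) (μ := Measure.count)
    (f := fun κ => EuclideanSpace.single (0 : Fin 1) (f.coeff κ)) two_ne_zero
  simp only [ENNReal.coe_ofNat, NNReal.coe_ofNat, ENNReal.rpow_ofNat] at h
  rw [latticeNorm, h, lintegral_count, tsum_eq_sum (s := f.coeff.support)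
    fun κ h => by rw [Finsupp.notMem_support_iff.1 h]; simp, coeffDot_self,
    ENNReal.ofReal_sum_of_nonneg fun _ _ => sq_nonneg _]
  refine Finset.sum_congr rfl fun κ _ => ?_
  rw [← ofReal_norm, ← ENNReal.ofReal_pow (norm_nonneg _)]
  simp

lemma integrable_translate_mul {ζ : EuclideanSpace ℝ (Fin d) → ℝ} (hc : Continuous ζ)
    (hs : HasCompactSupport ζ) (a b : EuclideanSpace ℝ (Fin d)) :
    Integrable fun x => ζ (x - a) * ζ (x - b) := by
  refine Continuous.integrable_of_hasCompactSupport (by fun_prop) ?_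
  have h1 : HasCompactSupport fun x => ζ (x - a) :=
    hs.comp_homeomorph (Homeomorph.subRight a)
  exact h1.mul_right

lemma synth_mul_synth (ζ : EuclideanSpace ℝ (Fin d) → ℝ) (f g : AddMonoidAlgebra ℝ (Fin d → ℤ))
    (x : EuclideanSpace ℝ (Fin d)) :
    synth ζ f x * synth ζ g x = ∑ η ∈ g.coeff.support, ∑ κ ∈ f.coeff.support,
      (g.coeff η * f.coeff κ) * (ζ (x - site κ) * ζ (x - site η)) := by
  rw [synth, synth, Finset.sum_mul_sum, Finset.sum_comm]
  refine Finset.sum_congr rfl fun η _ => Finset.sum_congr rfl fun κ _ => by ring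

lemma integrable_synth_mul {ζ : EuclideanSpace ℝ (Fin d) → ℝ} (hc : Continuous ζ)
    (hs : HasCompactSupport ζ) (f g : AddMonoidAlgebra ℝ (Fin d → ℤ)) :
    Integrable fun x => synth ζ f x * synth ζ g x := by
  simp only [synth_mul_synth]
  exact integrable_finsetSum _ fun η _ => integrable_finsetSum _ fun κ _ =>
    (integrable_translate_mul hc hs _ _).const_mul _

lemma eLpNorm_two_sq {ζ : EuclideanSpace ℝ (Fin d) → ℝ} (hc : Continuous ζ)
    (hs : HasCompactSupport ζ) (f : AddMonoidAlgebra ℝ (Fin d → ℤ)) :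
    eLpNorm (interp ζ fun κ => EuclideanSpace.single (0 : Fin 1) (f.coeff κ)) 2 volume ^ 2 =
      ENNReal.ofReal (∫ x, synth ζ f x * synth ζ f x) := by
  have h := eLpNorm_nnreal_pow_eq_lintegral (p := 2) (μ := volume)
    (f := interp ζ fun κ => EuclideanSpace.single (0 : Fin 1) (f.coeff κ)) two_ne_zero
  simp only [ENNReal.coe_ofNat, NNReal.coe_ofNat, ENNReal.rpow_ofNat] at h
  rw [h, ofReal_integral_eq_lintegral_ofReal (integrable_synth_mul hc hs f f)
    (Filter.Eventually.of_forall fun x => mul_self_nonneg _)]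
  refine lintegral_congr fun x => ?_
  rw [interp_coeff, ← ofReal_norm, ← ENNReal.ofReal_pow (norm_nonneg _)]
  simp [sq]

namespace IsNodalBasis

variable {ζ : EuclideanSpace ℝ (Fin d) → ℝ}

lemma interp_site (hζ : IsNodalBasis ζ) (u : (Fin d → ℤ) → EuclideanSpace ℝ (Fin m))
    (ξ : Fin d → ℤ) : interp ζ u (site ξ) = u ξ := by
  rw [interp, tsum_eq_single ξ]
  · rw [sub_self, hζ.at_zero, one_smul]
  · intro η hη
    rw [← site_sub, hζ.at_site _ (sub_ne_zero.2 hη.symm), zero_smul]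

/-- The lower Riesz bound: the coefficients are the values of the interpolant at the sites, so this
is the control of samples by the `L^p` norm with `p = 2`. -/
lemma coeffDot_le_integral (hζ : IsNodalBasis ζ) : ∃ c : ℝ, 0 < c ∧
    ∀ f, coeffDot d f f ≤ c * ∫ x, synth ζ f x * synth ζ f x := by
  obtain ⟨C, hC, h⟩ := latticeNorm_interp_le (m := 1) hζ.continuous hζ.hasCompactSupport 0
  refine ⟨(C : ℝ) ^ 2, by positivity, fun f => ?_⟩
  have h1 := h (fun κ => EuclideanSpace.single (0 : Fin 1) (f.coeff κ)) 2 one_le_two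
  simp only [zero_add, hζ.interp_site] at h1
  have h2 := pow_le_pow_left₀ zero_le h1 2
  rw [latticeNorm_two_sq, mul_pow, eLpNorm_two_sq hζ.continuous hζ.hasCompactSupport,
    ← ENNReal.ofReal_coe_nnreal, ← ENNReal.ofReal_pow (by positivity),
    ← ENNReal.ofReal_mul (by positivity)] at h2
  exact (ENNReal.ofReal_le_ofReal_iff (mul_nonneg (by positivity)
    (integral_nonneg fun x => mul_self_nonneg _))).1 h2

lemma integral_le_coeffDot (hζ : IsNodalBasis ζ) : ∃ c : ℝ, 0 < c ∧
    ∀ f, ∫ x, synth ζ f x * synth ζ f x ≤ c * coeffDot d f f := by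
  obtain ⟨C, hC, h⟩ := eLpNorm_interp_le (m := 1) hζ.continuous hζ.hasCompactSupport
  refine ⟨(C : ℝ) ^ 2, by positivity, fun f => ?_⟩
  have h2 := pow_le_pow_left₀ zero_le
    (h (fun κ => EuclideanSpace.single (0 : Fin 1) (f.coeff κ)) 2 one_le_two) 2
  rw [mul_pow, latticeNorm_two_sq, eLpNorm_two_sq hζ.continuous hζ.hasCompactSupport,
    ← ENNReal.ofReal_coe_nnreal, ← ENNReal.ofReal_pow (by positivity),
    ← ENNReal.ofReal_mul (by positivity)] at h2
  exact (ENNReal.ofReal_le_ofReal_iff (mul_nonneg (by positivity) (coeffDot_self_nonneg f))).1 h2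

end IsNodalBasis

/-! ### Inverting the Gram operator by a Neumann series -/

lemma coeff_sampling_zero {θ : EuclideanSpace ℝ (Fin d) → ℝ} {R : ℝ}
    (hR : ∀ x, R < ‖x‖ → θ x = 0) (κ : Fin d → ℤ) :
    (sampling θ (latticeBall d R) 0).coeff κ = θ (site κ) := by
  classical
  simp only [sampling, AddMonoidAlgebra.coeff_sum, AddMonoidAlgebra.coeff_single, zero_add,
    Finsupp.coe_finsetSum, Finset.sum_apply, Finsupp.single_apply, Finset.sum_ite_eq']
  split_ifs with h
  · rfl
  · exact (hR _ (by simpa using h)).symm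

/-- Evenness turns the inner product of the translates by `κ` and `η` into `(ζ * ζ)(η - κ)`. So
sampling `ũ` on the lattice itself is the Gram operator, symmetric and nonnegative. -/
lemma coeffDot_sampling_mul {ζ : EuclideanSpace ℝ (Fin d) → ℝ} (hc : Continuous ζ)
    (hs : HasCompactSupport ζ) (hsymm : ∀ x, ζ (-x) = ζ x) {R : ℝ}
    (hR : ∀ x, R < ‖x‖ → mollify ζ ζ x = 0) (f g : AddMonoidAlgebra ℝ (Fin d → ℤ)) :
    coeffDot d (sampling (mollify ζ ζ) (latticeBall d R) 0 * f) g =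
      ∫ x, synth ζ f x * synth ζ g x := by
  have hψ : ∀ κ η : Fin d → ℤ, ∫ x, ζ (x - site κ) * ζ (x - site η) =
      mollify ζ ζ (site (η - κ)) := fun κ η => by
    rw [mollify, ← integral_add_right_eq_self _ (site κ)]
    refine integral_congr_ae (Filter.Eventually.of_forall fun y => ?_)
    dsimp only
    rw [add_sub_cancel_right, mul_comm, ← hsymm, site_sub]
    congr 2
    abel
  simp only [synth_mul_synth]
  rw [coeffDot_comm, coeffDot_apply, integral_finsetSum _ fun η _ => integrable_finsetSum _
    fun κ _ => (integrable_translate_mul hc hs _ _).const_mul _]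
  refine Finset.sum_congr rfl fun η _ => ?_
  rw [integral_finsetSum _ fun κ _ => (integrable_translate_mul hc hs _ _).const_mul _,
    AddMonoidAlgebra.coeff_mul_apply_right, Finsupp.sum, Finset.mul_sum]
  refine Finset.sum_congr rfl fun κ _ => ?_
  rw [integral_const_mul, hψ, coeff_sampling_zero hR, sub_eq_add_neg]
  ring

/-- A self-adjoint element of the group algebra whose quadratic form lies between `0` and `ρ`
contracts the `ℓ²` norm by the factor `ρ`. -/
lemma coeffDot_mul_self_le {b : AddMonoidAlgebra ℝ (Fin d → ℤ)} {ρ : ℝ} (hρ : 0 ≤ ρ)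
    (hsymm : ∀ f g, coeffDot d (b * f) g = coeffDot d (b * g) f)
    (h0 : ∀ f, 0 ≤ coeffDot d (b * f) f) (h1 : ∀ f, coeffDot d (b * f) f ≤ ρ * coeffDot d f f)
    (f : AddMonoidAlgebra ℝ (Fin d → ℤ)) :
    coeffDot d (b * f) (b * f) ≤ ρ ^ 2 * coeffDot d f f := by
  let B : LinearMap.BilinForm ℝ (AddMonoidAlgebra ℝ (Fin d → ℤ)) :=
    coeffDot d ∘ₗ LinearMap.mulLeft ℝ b
  -- Cauchy-Schwarz for the nonnegative form of `b`, applied to `f` and `b * f`; symmetry turns both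
  -- factors on the left into the squared norm of `b * f`.
  have hcs : coeffDot d (b * f) (b * f) * coeffDot d (b * (b * f)) f ≤
      coeffDot d (b * f) f * coeffDot d (b * (b * f)) (b * f) :=
    LinearMap.BilinForm.apply_mul_apply_le_of_forall_zero_le B h0 f (b * f)
  rw [hsymm (b * f) f] at hcs
  set q := coeffDot d (b * f) (b * f) with hq
  have hq0 : 0 ≤ q := coeffDot_self_nonneg _
  have hf0 : 0 ≤ coeffDot d f f := coeffDot_self_nonneg _
  have h2 : q * q ≤ (ρ * coeffDot d f f) * (ρ * q) :=
    hcs.trans (mul_le_mul (h1 f) (h1 (b * f)) (h0 _) (by positivity))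
  rcases hq0.eq_or_lt with h | h
  · rw [← h]; positivity
  · refine le_of_mul_le_mul_right (h2.trans_eq ?_) h
    ring

lemma coeffDot_pow_le {b : AddMonoidAlgebra ℝ (Fin d → ℤ)} {ρ : ℝ}
    (h : ∀ f, coeffDot d (b * f) (b * f) ≤ ρ ^ 2 * coeffDot d f f) (n : ℕ) :
    coeffDot d (b ^ n) (b ^ n) ≤ (ρ ^ n) ^ 2 := by
  induction n with
  | zero => simp [coeffDot_one]
  | succ n ih =>
    rw [pow_succ']
    refine (h _).trans ?_
    calc ρ ^ 2 * coeffDot d (b ^ n) (b ^ n) ≤ ρ ^ 2 * (ρ ^ n) ^ 2 := by gcongr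
      _ = _ := by ring

lemma abs_coeff_pow_le {b : AddMonoidAlgebra ℝ (Fin d → ℤ)} {ρ : ℝ} (hρ : 0 ≤ ρ)
    (h : ∀ f, coeffDot d (b * f) (b * f) ≤ ρ ^ 2 * coeffDot d f f) (n : ℕ) (κ : Fin d → ℤ) :
    |(b ^ n).coeff κ| ≤ ρ ^ n :=
  abs_le_of_sq_le_sq ((coeff_sq_le_coeffDot _ κ).trans (coeffDot_pow_le h n)) (by positivity)

lemma coeff_pow_eq_zero {b : AddMonoidAlgebra ℝ (Fin d → ℤ)} {r : ℝ}
    (hb : ∀ κ, r < ‖site κ‖ → b.coeff κ = 0) (n : ℕ) (κ : Fin d → ℤ) (hκ : n * r < ‖site κ‖) :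
    (b ^ n).coeff κ = 0 := by
  induction n generalizing κ with
  | zero =>
    have : κ ≠ 0 := by rintro rfl; simp at hκ
    rw [pow_zero, AddMonoidAlgebra.one_def, AddMonoidAlgebra.coeff_single,
      Finsupp.single_eq_of_ne this]
  | succ n ih =>
    rw [pow_succ, AddMonoidAlgebra.coeff_mul_apply_right]
    refine Finset.sum_eq_zero fun η _ => ?_
    dsimp only
    rcases lt_or_ge r ‖site η‖ with h | h
    · rw [hb η h, mul_zero]
    · rw [ih, zero_mul]
      rw [← sub_eq_add_neg, site_sub]
      have := norm_sub_norm_le (site κ) (site η)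
      push_cast at hκ
      linarith

lemma card_latticeBall_le {r : ℝ} (hr : 0 ≤ r) : ((latticeBall d r).card : ℝ) ≤ (2 * r + 3) ^ d := by
  have hsub : latticeBall d r ⊆ Finset.Icc (fun _ => -⌈r⌉) fun _ => ⌈r⌉ := by
    intro ξ hξ
    rw [mem_latticeBall] at hξ
    have h : ∀ i, |(ξ i : ℝ)| ≤ r := fun i =>
      (by simpa using PiLp.norm_apply_le (site ξ) i : |(ξ i : ℝ)| ≤ ‖site ξ‖).trans hξ
    rw [Finset.mem_Icc]
    refine ⟨fun i => ?_, fun i => ?_⟩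
    · have := (abs_le.1 ((h i).trans (Int.le_ceil r))).1
      exact_mod_cast this
    · have := (abs_le.1 ((h i).trans (Int.le_ceil r))).2
      exact_mod_cast this
  calc ((latticeBall d r).card : ℝ)
      ≤ ((Finset.Icc (fun _ : Fin d => -⌈r⌉) fun _ => ⌈r⌉).card : ℝ) := by
        exact_mod_cast Finset.card_le_card hsub
    _ = (((⌈r⌉ + 1 - -⌈r⌉).toNat : ℕ) : ℝ) ^ d := by simp [Pi.card_Icc]
    _ ≤ (2 * r + 3) ^ d := by
        gcongr
        have h0 : 0 ≤ ⌈r⌉ := Int.ceil_nonneg hr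
        have h1 : (((⌈r⌉ + 1 - -⌈r⌉).toNat : ℤ) : ℝ) = ((⌈r⌉ + 1 - -⌈r⌉ : ℤ) : ℝ) := by
          rw [Int.toNat_of_nonneg (by linarith)]
        rw [Int.cast_natCast] at h1
        rw [h1]
        push_cast
        linarith [(Int.ceil_lt_add_one r).le]

/-- Each coefficient of `b ^ n` is at most `ρ ^ n` by the `ℓ²` contraction, and at most polynomially
many are nonzero. This converts an `ℓ²` estimate into an `ℓ¹` one, valid for all `p`. -/
lemma sum_norm_coeff_pow_le {b : AddMonoidAlgebra ℝ (Fin d → ℤ)} {ρ r : ℝ} (hρ : 0 ≤ ρ)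
    (hr : 0 ≤ r) (h : ∀ f, coeffDot d (b * f) (b * f) ≤ ρ ^ 2 * coeffDot d f f)
    (hb : ∀ κ, r < ‖site κ‖ → b.coeff κ = 0) (n : ℕ) :
    ∑ κ ∈ (b ^ n).coeff.support, ‖(b ^ n).coeff κ‖ ≤ (2 * r + 3) ^ d * ((n + 1 : ℝ) ^ d * ρ ^ n) := by
  have hsub : (b ^ n).coeff.support ⊆ latticeBall d (n * r) := fun κ hκ => by
    by_contra hcon
    simp only [mem_latticeBall, not_le] at hcon
    exact (Finsupp.mem_support_iff.1 hκ) (coeff_pow_eq_zero hb n κ hcon)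
  calc ∑ κ ∈ (b ^ n).coeff.support, ‖(b ^ n).coeff κ‖
      ≤ ∑ κ ∈ latticeBall d (n * r), ‖(b ^ n).coeff κ‖ :=
        Finset.sum_le_sum_of_subset_of_nonneg hsub fun _ _ _ => norm_nonneg _
    _ ≤ ∑ κ ∈ latticeBall d (n * r), ρ ^ n :=
        Finset.sum_le_sum fun κ _ => abs_coeff_pow_le hρ h n κ
    _ = (latticeBall d (n * r)).card * ρ ^ n := by simp
    _ ≤ (2 * (n * r) + 3) ^ d * ρ ^ n := by gcongr; exact card_latticeBall_le (by positivity)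
    _ ≤ ((2 * r + 3) * (n + 1)) ^ d * ρ ^ n := by
        gcongr
        nlinarith [n.cast_nonneg (α := ℝ)]
    _ = _ := by rw [mul_pow]; ring

lemma summable_succ_pow_mul_geometric (k : ℕ) {ρ : ℝ} (h0 : 0 < ρ) (h1 : ρ < 1) :
    Summable fun n : ℕ => (n + 1 : ℝ) ^ k * ρ ^ n := by
  have h := (summable_nat_add_iff 1).2 (summable_pow_mul_geometric_of_norm_lt_one k
    (r := ρ) (by rwa [Real.norm_eq_abs, abs_of_pos h0]))
  refine (h.mul_right ρ⁻¹).congr fun n => ?_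
  push_cast
  rw [pow_succ, ← mul_assoc, mul_inv_cancel_right₀ h0.ne']

/-- Powers of a contracting element of the group algebra tend to zero on functions of polynomial
growth. -/
lemma tendsto_shiftAction_pow {b : AddMonoidAlgebra ℝ (Fin d → ℤ)} {ρ r : ℝ} (h0 : 0 < ρ)
    (h1 : ρ < 1) (hr : 0 ≤ r) (h : ∀ f, coeffDot d (b * f) (b * f) ≤ ρ ^ 2 * coeffDot d f f)
    (hb : ∀ κ, r < ‖site κ‖ → b.coeff κ = 0) {u : (Fin d → ℤ) → EuclideanSpace ℝ (Fin m)}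
    (hu : PolynomialGrowth u) (ξ : Fin d → ℤ) :
    Filter.Tendsto (fun n => shiftAction d m (b ^ n) u ξ) Filter.atTop (nhds 0) := by
  obtain ⟨N, K, hK⟩ := hu
  have hK0 : 0 ≤ K := by
    have := (norm_nonneg _).trans (hK 0)
    exact nonneg_of_mul_nonneg_left this (by positivity)
  set D := (2 * r + 3) ^ d * (K * (1 + ‖site ξ‖ + r) ^ N)
  have hlim : Filter.Tendsto (fun n : ℕ => D * ((n + 1 : ℝ) ^ (d + N) * ρ ^ n)) Filter.atTop (nhds 0) := by
    simpa using (summable_succ_pow_mul_geometric (d + N) h0 h1).tendsto_atTop_zero.const_mul D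
  refine squeeze_zero_norm (fun n => ?_) hlim
  rw [shiftAction_apply]
  calc ‖∑ κ ∈ (b ^ n).coeff.support, (b ^ n).coeff κ • u (ξ - κ)‖
      ≤ ∑ κ ∈ (b ^ n).coeff.support, ‖(b ^ n).coeff κ‖ * (K * (1 + ‖site ξ‖ + n * r) ^ N) := by
        refine (norm_sum_le _ _).trans (Finset.sum_le_sum fun κ hκ => ?_)
        rw [norm_smul]
        have hκr : ‖site κ‖ ≤ n * r := by
          by_contra hcon
          exact (Finsupp.mem_support_iff.1 hκ) (coeff_pow_eq_zero hb n κ (not_le.1 hcon))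
        gcongr
        refine (hK _).trans ?_
        have hsub : 1 + ‖site (ξ - κ)‖ ≤ 1 + ‖site ξ‖ + n * r := by
          rw [site_sub]
          linarith [norm_sub_le (site ξ) (site κ)]
        gcongr
    _ ≤ ((2 * r + 3) ^ d * ((n + 1 : ℝ) ^ d * ρ ^ n)) * (K * ((1 + ‖site ξ‖ + r) * (n + 1)) ^ N) := by
        rw [← Finset.sum_mul]
        gcongr
        · exact sum_norm_coeff_pow_le h0.le hr h hb n
        · nlinarith [n.cast_nonneg (α := ℝ), norm_nonneg (site ξ),
            mul_nonneg (n.cast_nonneg (α := ℝ)) (norm_nonneg (site ξ))]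
    _ = _ := by rw [mul_pow, pow_add]; ring

/-- Inversion of the discrete convolution `u ↦ ũ|_{ℤ^d}` on functions of polynomial growth. -/
lemma IsNodalBasis.latticeNorm_le_latticeNorm_quasiInterp {ζ : EuclideanSpace ℝ (Fin d) → ℝ}
    (hζ : IsNodalBasis ζ) (hsymm : ∀ x, ζ (-x) = ζ x) : ∃ C : ℝ≥0, 0 < C ∧
      ∀ u : (Fin d → ℤ) → EuclideanSpace ℝ (Fin m), PolynomialGrowth u → ∀ p : ℝ≥0∞, 1 ≤ p →
        latticeNorm p u ≤ C * latticeNorm p fun ξ => quasiInterp ζ u (site ξ) := by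
  obtain ⟨R, hR0, hR⟩ := hζ.hasCompactSupport'
  have hψR : ∀ x, R + R < ‖x‖ → mollify ζ ζ x = 0 := fun x hx => mollify_eq_zero hR hR hx
  set a := sampling (mollify ζ ζ) (latticeBall d (R + R)) 0 with ha
  have hgram := coeffDot_sampling_mul hζ.continuous hζ.hasCompactSupport hsymm hψR
  rw [← ha] at hgram
  obtain ⟨c, hc, hlow⟩ := hζ.coeffDot_le_integral
  obtain ⟨L, hL, hup⟩ := hζ.integral_le_coeffDot
  -- Dividing by the upper Riesz constant `L` places the form of `b` between `0` and `1 - 1 / (L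
  -- c)`.
  set b := 1 - L⁻¹ • a with hbdef
  have hbf : ∀ f g, coeffDot d (b * f) g =
      coeffDot d f g - L⁻¹ * ∫ x, synth ζ f x * synth ζ g x := fun f g => by
    rw [hbdef, sub_mul, one_mul, smul_mul_assoc, map_sub, map_smul, LinearMap.sub_apply,
      LinearMap.smul_apply, hgram, smul_eq_mul]
  -- The maximum with `1 / 2` only keeps `ρ` strictly positive, as the geometric series lemma asks.
  set ρ := max (1 - L⁻¹ * c⁻¹) (1 / 2)
  have hρ0 : 0 < ρ := lt_of_lt_of_le one_half_pos (le_max_right _ _)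
  have hρ1 : ρ < 1 := max_lt (by linarith [mul_pos (inv_pos.2 hL) (inv_pos.2 hc)]) (by norm_num)
  have hcontr := coeffDot_mul_self_le (b := b) hρ0.le
    (fun f g => by rw [hbf, hbf, coeffDot_comm f g]; simp only [mul_comm])
    (fun f => by
      rw [hbf, sub_nonneg]
      calc L⁻¹ * ∫ x, synth ζ f x * synth ζ f x ≤ L⁻¹ * (L * coeffDot d f f) := by
            gcongr; exact hup f
        _ = _ := by field_simp)
    (fun f => by
      rw [hbf]
      have h1 : c⁻¹ * coeffDot d f f ≤ ∫ x, synth ζ f x * synth ζ f x := by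
        rw [inv_mul_le_iff₀ hc]; exact hlow f
      calc coeffDot d f f - L⁻¹ * ∫ x, synth ζ f x * synth ζ f x
          ≤ coeffDot d f f - L⁻¹ * (c⁻¹ * coeffDot d f f) := by gcongr
        _ = (1 - L⁻¹ * c⁻¹) * coeffDot d f f := by ring
        _ ≤ ρ * coeffDot d f f :=
          mul_le_mul_of_nonneg_right (le_max_left _ _) (coeffDot_self_nonneg f))
  have hbR : ∀ κ : Fin d → ℤ, R + R < ‖site κ‖ → b.coeff κ = 0 := fun κ hκ => by
    have hκ0 : κ ≠ 0 := by
      rintro rfl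
      simp only [site_zero, norm_zero] at hκ
      linarith
    rw [hbdef, AddMonoidAlgebra.coeff_sub, AddMonoidAlgebra.coeff_smul, Finsupp.sub_apply,
      Finsupp.smul_apply, ha, coeff_sampling_zero hψR, hψR _ hκ, AddMonoidAlgebra.one_def,
      AddMonoidAlgebra.coeff_single, Finsupp.single_eq_of_ne hκ0]
    simp
  set s : ℕ → ℝ := fun n => ∑ κ ∈ (b ^ n).coeff.support, ‖(b ^ n).coeff κ‖ with hs
  have hs0 : ∀ n, 0 ≤ s n := fun n => Finset.sum_nonneg fun _ _ => norm_nonneg _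
  have hsum : Summable s := Summable.of_nonneg_of_le hs0
    (sum_norm_coeff_pow_le hρ0.le (by positivity) hcontr hbR)
    ((summable_succ_pow_mul_geometric d hρ0 hρ1).mul_left _)
  refine ⟨(∑' n, s n).toNNReal * ‖L⁻¹‖₊ + 1, by positivity, fun u hu p hp => ?_⟩
  set v : (Fin d → ℤ) → EuclideanSpace ℝ (Fin m) := fun ξ => quasiInterp ζ u (site ξ) with hv
  have hav : shiftAction d m a u = v := by
    ext1 ξ
    have := shiftAction_sampling hψR 0 u ξ
    rw [norm_zero, add_zero, zero_add] at this
    rw [ha, this, hv, hζ.quasiInterp_eq]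
  -- The telescoped geometric series is a finite identity, so it holds with no growth assumption;
  -- growth matters only for the remainder `b ^ n` acting on `u`.
  have hneumann : ∀ n, u - shiftAction d m (b ^ n) u =
      ∑ i ∈ Finset.range n, shiftAction d m (b ^ i) (L⁻¹ • v) := fun n => by
    have h1 : (∑ i ∈ Finset.range n, b ^ i) * (L⁻¹ • a) = 1 - b ^ n := by
      rw [← geom_sum_mul_neg b n, hbdef]
      congr 1
      abel
    have h2 := congrArg (fun f => shiftAction d m f u) h1
    simp only [map_mul, map_sum, map_smul, map_sub, map_one, LinearMap.sub_apply,
      Module.End.one_apply, Module.End.mul_apply, LinearMap.sum_apply, LinearMap.smul_apply,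
      hav] at h2
    rw [← h2, Finset.smul_sum]
    simp only [map_smul]
  have hlim : ∀ ξ, Filter.Tendsto (fun n => (u - shiftAction d m (b ^ n) u) ξ) Filter.atTop
      (nhds (u ξ)) := fun ξ => by
    simpa using (tendsto_shiftAction_pow hρ0 hρ1 (by positivity) hcontr hbR hu ξ).const_sub (u ξ)
  have hbound : ∀ n, latticeNorm p (u - shiftAction d m (b ^ n) u) ≤
      ((∑' n, s n).toNNReal * ‖L⁻¹‖₊ + 1 : ℝ≥0) * latticeNorm p v := fun n => by
    rw [hneumann]
    calc latticeNorm p (∑ i ∈ Finset.range n, shiftAction d m (b ^ i) (L⁻¹ • v))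
        ≤ ∑ i ∈ Finset.range n, latticeNorm p (shiftAction d m (b ^ i) (L⁻¹ • v)) :=
          eLpNorm_sum_le (fun _ _ => .of_discrete) hp
      _ ≤ ∑ i ∈ Finset.range n, ((s i).toNNReal : ℝ≥0∞) * (‖L⁻¹‖₊ * latticeNorm p v) := by
          refine Finset.sum_le_sum fun i _ => (latticeNorm_shiftAction_le _ _ hp).trans ?_
          have h1 : ∑ κ ∈ (b ^ i).coeff.support, ‖(b ^ i).coeff κ‖₊ = (s i).toNNReal := by
            rw [hs, Real.toNNReal_sum_of_nonneg fun _ _ => norm_nonneg _]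
            exact Finset.sum_congr rfl fun κ _ => norm_toNNReal.symm
          rw [h1, latticeNorm, eLpNorm_const_smul, enorm_eq_nnnorm]
          rfl
      _ = ((∑ i ∈ Finset.range n, s i).toNNReal * ‖L⁻¹‖₊ : ℝ≥0) * latticeNorm p v := by
          rw [← Finset.sum_mul, ← mul_assoc, Real.toNNReal_sum_of_nonneg fun i _ => hs0 i]
          push_cast
          rfl
      _ ≤ _ := by
          gcongr
          refine le_trans ?_ le_self_add
          gcongr
          exact hsum.sum_le_tsum _ fun i _ => hs0 i
  -- Fatou's lemma upgrades the uniform bounds on the partial sums to the pointwise limit `u`, whose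
  -- norm may a priori be infinite.
  calc latticeNorm p u ≤ Filter.atTop.liminf fun n => latticeNorm p (u - shiftAction d m (b ^ n) u) :=
        Lp.eLpNorm_lim_le_liminf_eLpNorm (fun n => .of_discrete) u
          (Filter.Eventually.of_forall hlim)
    _ ≤ _ := Filter.liminf_le_of_le (by isBoundedDefault) fun c hc => by
        obtain ⟨n, hn⟩ := hc.exists
        exact hn.trans (hbound n)

/-! ### Weak gradients -/

section WeakGradient

variable {F : Type*} [NormedAddCommGroup F]

lemma locallyIntegrable_apply {G : EuclideanSpace ℝ (Fin d) → PiLp 2 (fun _ : Fin d => F)}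
    (hG : LocallyIntegrable G volume) (j : Fin d) : LocallyIntegrable (fun x => G x j) volume :=
  locallyIntegrable_iff.2 fun K hK => (locallyIntegrable_iff.1 hG K hK).eval_piLp j

lemma locallyIntegrable_of_apply {G : EuclideanSpace ℝ (Fin d) → PiLp 2 (fun _ : Fin d => F)}
    (hG : ∀ j, LocallyIntegrable (fun x => G x j) volume) : LocallyIntegrable G volume :=
  locallyIntegrable_iff.2 fun K hK =>
    Integrable.of_eval_piLp fun j => locallyIntegrable_iff.1 (hG j) K hK

variable [NormedSpace ℝ F]

/-- Uniqueness lets estimates for the explicit gradient fields apply to every weak gradient. -/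
lemma IsWeakGradient.ae_eq [CompleteSpace F] {f : EuclideanSpace ℝ (Fin d) → F}
    {G G' : EuclideanSpace ℝ (Fin d) → PiLp 2 (fun _ : Fin d => F)} (h : IsWeakGradient f G)
    (h' : IsWeakGradient f G') : G =ᵐ[volume] G' := by
  have h1 : ∀ j, ∀ᵐ x, G x j = G' x j := fun j =>
    ae_eq_of_integral_contDiff_smul_eq (locallyIntegrable_apply h.locallyIntegrable_grad j)
      (locallyIntegrable_apply h'.locallyIntegrable_grad j) fun φ hφ hs => by
        rw [← neg_inj, ← h.integral_eq φ hφ hs j, ← h'.integral_eq φ hφ hs j]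
  filter_upwards [ae_all_iff.2 h1] with x hx
  ext j
  exact hx j

/-- The partial derivative in the direction of the `j`-th coordinate. -/
def partialDeriv (j : Fin d) (φ : EuclideanSpace ℝ (Fin d) → ℝ) (x : EuclideanSpace ℝ (Fin d)) : ℝ :=
  fderiv ℝ φ x (EuclideanSpace.single j 1)

lemma continuous_partialDeriv {φ : EuclideanSpace ℝ (Fin d) → ℝ} (hφ : ContDiff ℝ ∞ φ) (j : Fin d) :
    Continuous (partialDeriv j φ) :=
  (hφ.continuous_fderiv (by simp)).clm_apply continuous_const

lemma hasCompactSupport_partialDeriv {φ : EuclideanSpace ℝ (Fin d) → ℝ} (hs : HasCompactSupport φ)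
    (j : Fin d) : HasCompactSupport (partialDeriv j φ) :=
  hs.fderiv_apply ℝ _

lemma partialDeriv_comp_add_right (φ : EuclideanSpace ℝ (Fin d) → ℝ) (j : Fin d)
    (a x : EuclideanSpace ℝ (Fin d)) :
    partialDeriv j (fun y => φ (y + a)) x = partialDeriv j φ (x + a) := by
  rw [partialDeriv, fderiv_comp_add_right, partialDeriv]

lemma integral_partialDeriv {φ : EuclideanSpace ℝ (Fin d) → ℝ} (hφ : ContDiff ℝ ∞ φ)
    (hs : HasCompactSupport φ) (j : Fin d) : ∫ x, partialDeriv j φ x = 0 := by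
  have h1 : Integrable (partialDeriv j φ) :=
    (continuous_partialDeriv hφ j).integrable_of_hasCompactSupport (hasCompactSupport_partialDeriv hs j)
  have h2 : Integrable φ := hφ.continuous.integrable_of_hasCompactSupport hs
  have h := integral_mul_fderiv_eq_neg_fderiv_mul_of_integrable (μ := volume)
    (f := fun _ : EuclideanSpace ℝ (Fin d) => (1 : ℝ)) (g := φ) (v := EuclideanSpace.single j 1)
    (by simp) (by simpa using! h1) (by simpa using h2)
    (fun x _ => differentiableAt_const _) (fun x _ => hφ.differentiable (by simp) x)
  simpa [partialDeriv] using h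

lemma isWeakGradient_const [CompleteSpace F] (c : F) :
    IsWeakGradient (fun _ : EuclideanSpace ℝ (Fin d) => c) fun _ => 0 where
  locallyIntegrable := locallyIntegrable_const c
  locallyIntegrable_grad := locallyIntegrable_const 0
  integral_eq φ hφ hs j := by
    rw [integral_smul_const]
    change (∫ x, partialDeriv j φ x) • c = _
    simp [integral_partialDeriv hφ hs j]

end WeakGradient

/-- `θ` and `k j` are integrable with compact support, and `k j` is the weak `j`-th partial
derivative of `θ`. -/
structure IsWeakPartials (θ : EuclideanSpace ℝ (Fin d) → ℝ)
    (k : Fin d → EuclideanSpace ℝ (Fin d) → ℝ) : Prop where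
  integrable : Integrable θ
  hasCompactSupport : HasCompactSupport θ
  integrable_partial : ∀ j, Integrable (k j)
  hasCompactSupport_partial : ∀ j, HasCompactSupport (k j)
  integral_eq : ∀ φ : EuclideanSpace ℝ (Fin d) → ℝ, ContDiff ℝ ∞ φ → HasCompactSupport φ →
    ∀ j, ∫ x, partialDeriv j φ x * θ x = - ∫ x, φ x * k j x

lemma IsWeakPartials.integral_comp_add {θ : EuclideanSpace ℝ (Fin d) → ℝ}
    {k : Fin d → EuclideanSpace ℝ (Fin d) → ℝ} (h : IsWeakPartials θ k)
    {φ : EuclideanSpace ℝ (Fin d) → ℝ} (hφ : ContDiff ℝ ∞ φ) (hs : HasCompactSupport φ)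
    (j : Fin d) (a : EuclideanSpace ℝ (Fin d)) :
    ∫ x, partialDeriv j φ (x + a) * θ x = - ∫ x, φ (x + a) * k j x := by
  rw [← h.integral_eq (fun x => φ (x + a)) (hφ.comp (contDiff_id.add contDiff_const))
    (hs.comp_homeomorph (Homeomorph.addRight a)) j]
  simp only [partialDeriv_comp_add_right]

/-- The nodal basis function has bounded weak partial derivatives with compact support. -/
lemma IsNodalBasis.exists_isWeakPartials {ζ : EuclideanSpace ℝ (Fin d) → ℝ} (hζ : IsNodalBasis ζ) :
    ∃ k : Fin d → EuclideanSpace ℝ (Fin d) → ℝ, IsWeakPartials ζ k ∧ ∃ M : ℝ, ∀ j x, ‖k j x‖ ≤ M := by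
  obtain ⟨R, -, hR⟩ := hζ.hasCompactSupport'
  obtain ⟨-, G, hG, hGb⟩ := hζ.memW1Infty
  set M := (eLpNormEssSup G volume).toReal
  have hMb : ∀ᵐ x, ‖G x‖ ≤ M := by
    have hfin : eLpNormEssSup G volume ≠ ⊤ := by
      rw [← eLpNorm_exponent_top]; exact hGb.eLpNorm_ne_top
    filter_upwards [enorm_ae_le_eLpNormEssSup G volume] with x hx
    rw [← toReal_enorm]
    exact ENNReal.toReal_mono hfin hx
  -- Off the ball containing the support of `ζ`, testing with functions supported there shows that
  -- the gradient vanishes almost everywhere.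
  have hout : ∀ j, ∀ᵐ x, R < ‖x‖ → G x j = 0 := fun j => by
    refine IsOpen.ae_eq_zero_of_integral_contDiff_smul_eq_zero (U := {x | R < ‖x‖})
      (isOpen_lt continuous_const continuous_norm)
      ((locallyIntegrable_apply hG.locallyIntegrable_grad j).locallyIntegrableOn _)
      fun φ hφ hs hsub => ?_
    rw [← neg_eq_zero, ← hG.integral_eq φ hφ hs j]
    refine integral_eq_zero_of_ae (Filter.Eventually.of_forall fun x => ?_)
    rcases lt_or_ge R ‖x‖ with hx | hx
    · simp [hR x hx]
    · have : x ∉ tsupport φ := fun h => absurd (hsub h) (not_lt.2 hx)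
      have h0 : fderiv ℝ φ x = 0 := by
        by_contra h
        exact this (support_fderiv_subset ℝ (Function.mem_support.2 h))
      simp [h0]
  have hae : ∀ᵐ x, ‖G x‖ ≤ M ∧ ∀ j, R < ‖x‖ → G x j = 0 := by
    filter_upwards [hMb, ae_all_iff.2 hout] with x h1 h2 using ⟨h1, h2⟩
  classical
  -- Changing `G` on a null set makes the bound and the support condition hold at every point, so
  -- that the sums over translates are finite everywhere.
  set k : Fin d → EuclideanSpace ℝ (Fin d) → ℝ := fun j x =>
    if ‖G x‖ ≤ M ∧ ∀ j, R < ‖x‖ → G x j = 0 then G x j else 0 with hk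
  have hkG : ∀ j, k j =ᵐ[volume] fun x => G x j := fun j => by
    filter_upwards [hae] with x hx
    simp [hk, if_pos hx]
  have hkR : ∀ j x, R < ‖x‖ → k j x = 0 := fun j x hx => by
    simp only [hk]
    split_ifs with h
    · exact h.2 j hx
    · rfl
  have hM0 : 0 ≤ M := ENNReal.toReal_nonneg
  have hkM : ∀ j x, ‖k j x‖ ≤ M := fun j x => by
    simp only [hk]
    split_ifs with h
    · exact (PiLp.norm_apply_le _ j).trans h.1
    · simpa using hM0
  have hkl : ∀ j, LocallyIntegrable (k j) volume := fun j =>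
    (locallyIntegrable_apply hG.locallyIntegrable_grad j).congr (hkG j).symm
  refine ⟨k, ⟨hζ.integrable, hζ.hasCompactSupport, fun j => ?_, fun j =>
    hasCompactSupport_of_forall_norm_lt (hkR j), fun φ hφ hs j => ?_⟩, M, hkM⟩
  · refine ((hkl j).integrableOn_isCompact (isCompact_closedBall 0 R)).integrable_of_forall_notMem_eq_zero
      fun x hx => hkR j x (by simpa using hx)
  · refine (hG.integral_eq φ hφ hs j).trans ?_
    congr 1
    refine integral_congr_ae ?_
    filter_upwards [hkG j] with x hx
    rw [hx, smul_eq_mul]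

/-! ### Weak gradients of interpolants -/

lemma locallyIntegrable_interp {k : EuclideanSpace ℝ (Fin d) → ℝ} (hk : Integrable k)
    (hs : HasCompactSupport k) (u : (Fin d → ℤ) → EuclideanSpace ℝ (Fin m)) :
    LocallyIntegrable (interp k u) volume := by
  obtain ⟨R, -, hR⟩ := hs.exists_forall_norm_lt_eq_zero
  refine locallyIntegrable_iff.2 fun K hK => ?_
  obtain ⟨r, hr⟩ := hK.isBounded.subset_closedBall 0
  refine IntegrableOn.congr_fun (f := fun x => ∑ ξ ∈ latticeBall d (R + r), k (x - site ξ) • u ξ) ?_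
    (fun x hx => (interp_eq_sum hR u (by simpa using hr hx)).symm) hK.measurableSet
  exact (integrable_finsetSum _ fun ξ _ => (hk.comp_sub_right (site ξ)).smul_const _).integrableOn

lemma integral_smul_interp_eq_sum {k χ : EuclideanSpace ℝ (Fin d) → ℝ} (hk : Integrable k)
    (hχ : Continuous χ) (hχs : HasCompactSupport χ) {R r : ℝ} (hR : ∀ x, R < ‖x‖ → k x = 0)
    (hr : ∀ x, r < ‖x‖ → χ x = 0) (u : (Fin d → ℤ) → EuclideanSpace ℝ (Fin m)) :
    ∫ x, χ x • interp k u x =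
      ∑ ξ ∈ latticeBall d (R + r), (∫ x, χ (x + site ξ) * k x) • u ξ := by
  obtain ⟨M, hM⟩ := hχs.exists_bound_of_continuous hχ
  have h1 : ∀ x, χ x • interp k u x =
      ∑ ξ ∈ latticeBall d (R + r), (χ x * k (x - site ξ)) • u ξ := fun x => by
    rcases lt_or_ge r ‖x‖ with hx | hx
    · simp [hr x hx]
    · simp only [interp_eq_sum hR u hx, Finset.smul_sum, smul_smul]
  simp only [h1]
  rw [integral_finsetSum]
  · refine Finset.sum_congr rfl fun ξ _ => ?_
    rw [integral_smul_const, ← integral_add_right_eq_self _ (site ξ)]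
    simp
  · intro ξ _
    exact ((hk.comp_sub_right (site ξ)).bdd_mul (c := M) hχ.aestronglyMeasurable
      (Filter.Eventually.of_forall hM)).smul_const _

/-- The gradient field assembled from the interpolants of the partial derivatives. -/
def interpGrad (k : Fin d → EuclideanSpace ℝ (Fin d) → ℝ)
    (u : (Fin d → ℤ) → EuclideanSpace ℝ (Fin m)) (x : EuclideanSpace ℝ (Fin d)) :
    PiLp 2 (fun _ : Fin d => EuclideanSpace ℝ (Fin m)) :=
  WithLp.toLp 2 fun j => interp (k j) u x

/-- Fubini's theorem for the pairing of a mollified function with a bounded continuous one. -/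
lemma integral_mul_mollify {χ ζ f : EuclideanSpace ℝ (Fin d) → ℝ}
    (hχ : Continuous χ) (hχs : HasCompactSupport χ) (hζ : Integrable ζ) (hf : Integrable f) :
    ∫ x, χ x * mollify ζ f x = ∫ y, ζ y * ∫ x, χ (x + y) * f x := by
  obtain ⟨M, hM⟩ := hχs.exists_bound_of_continuous hχ
  have hint : Integrable fun z : EuclideanSpace ℝ (Fin d) × EuclideanSpace ℝ (Fin d) =>
      χ z.1 * (ζ z.2 * f (z.1 - z.2)) :=
    (hζ.convolution_integrand (ContinuousLinearMap.mul ℝ ℝ) hf).bdd_mul (c := M)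
      (hχ.comp continuous_fst).aestronglyMeasurable (Filter.Eventually.of_forall fun z => hM _)
  have h1 : ∀ x, χ x * mollify ζ f x = ∫ y, χ x * (ζ y * f (x - y)) := fun x => by
    rw [integral_const_mul, mollify, ← integral_sub_left_eq_self _ _ x]
    simp
  simp only [h1]
  rw [integral_integral_swap hint]
  refine integral_congr_ae (Filter.Eventually.of_forall fun y => ?_)
  dsimp only
  rw [← integral_const_mul, ← integral_add_right_eq_self _ y]
  refine integral_congr_ae (Filter.Eventually.of_forall fun x => ?_)
  simp only [add_sub_cancel_right]
  ring

namespace IsWeakPartials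

variable {θ : EuclideanSpace ℝ (Fin d) → ℝ} {k : Fin d → EuclideanSpace ℝ (Fin d) → ℝ}

lemma isWeakGradient_interp (h : IsWeakPartials θ k)
    (u : (Fin d → ℤ) → EuclideanSpace ℝ (Fin m)) :
    IsWeakGradient (interp θ u) (interpGrad k u) where
  locallyIntegrable := locallyIntegrable_interp h.integrable h.hasCompactSupport u
  locallyIntegrable_grad := locallyIntegrable_of_apply fun j =>
    locallyIntegrable_interp (h.integrable_partial j) (h.hasCompactSupport_partial j) u
  integral_eq φ hφ hs j := by
    obtain ⟨R₁, -, hR₁⟩ := h.hasCompactSupport.exists_forall_norm_lt_eq_zero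
    obtain ⟨R₂, -, hR₂⟩ := (h.hasCompactSupport_partial j).exists_forall_norm_lt_eq_zero
    obtain ⟨r₁, -, hr₁⟩ := hs.exists_forall_norm_lt_eq_zero
    obtain ⟨r₂, -, hr₂⟩ := (hasCompactSupport_partialDeriv hs j).exists_forall_norm_lt_eq_zero
    refine (integral_smul_interp_eq_sum (R := max R₁ R₂) (r := max r₁ r₂) h.integrable
      (continuous_partialDeriv hφ j) (hasCompactSupport_partialDeriv hs j)
      (fun x hx => hR₁ x (lt_of_le_of_lt (le_max_left _ _) hx))
      (fun x hx => hr₂ x (lt_of_le_of_lt (le_max_right _ _) hx)) u).trans ?_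
    refine Eq.trans ?_ (congrArg Neg.neg (integral_smul_interp_eq_sum (R := max R₁ R₂)
      (r := max r₁ r₂) (h.integrable_partial j) hφ.continuous hs
      (fun x hx => hR₂ x (lt_of_le_of_lt (le_max_right _ _) hx))
      (fun x hx => hr₁ x (lt_of_le_of_lt (le_max_left _ _) hx)) u)).symm
    rw [← Finset.sum_neg_distrib]
    exact Finset.sum_congr rfl fun ξ _ => by rw [h.integral_comp_add hφ hs, neg_smul]

/-- The defining identity for translated test functions, integrated against `ζ y`. Each derivative
falls on one factor only, so `ζ * k j` is continuous even though `k j` need not be. -/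
lemma mollify (h : IsWeakPartials θ k) {ζ : EuclideanSpace ℝ (Fin d) → ℝ} (hζ : Integrable ζ)
    (hζs : HasCompactSupport ζ) :
    IsWeakPartials (LatticeInterp.mollify ζ θ) fun j => LatticeInterp.mollify ζ (k j) where
  integrable := integrable_mollify hζ h.integrable
  hasCompactSupport := hasCompactSupport_mollify hζs h.hasCompactSupport
  integrable_partial j := integrable_mollify hζ (h.integrable_partial j)
  hasCompactSupport_partial j := hasCompactSupport_mollify hζs (h.hasCompactSupport_partial j)
  integral_eq φ hφ hs j := by
    rw [integral_mul_mollify (continuous_partialDeriv hφ j) (hasCompactSupport_partialDeriv hs j) hζ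
      h.integrable, integral_mul_mollify hφ.continuous hs hζ (h.integrable_partial j),
      ← integral_neg]
    simp only [h.integral_comp_add hφ hs, mul_neg]

end IsWeakPartials

/-! ### Differences along lattice vectors -/

lemma fderiv_apply_eq_sum (φ : EuclideanSpace ℝ (Fin d) → ℝ) (x s : EuclideanSpace ℝ (Fin d)) :
    fderiv ℝ φ x s = ∑ j, s j * partialDeriv j φ x := by
  conv_lhs => rw [← (EuclideanSpace.basisFun (Fin d) ℝ).sum_repr s, map_sum]
  simp [partialDeriv]

lemma sub_eq_intervalIntegral_partialDeriv {φ : EuclideanSpace ℝ (Fin d) → ℝ}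
    (hφ : ContDiff ℝ ∞ φ) (s x : EuclideanSpace ℝ (Fin d)) :
    φ (x + -s) - φ x = ∫ t in (0 : ℝ)..1, -∑ j, s j * partialDeriv j φ (x + -(t • s)) := by
  have hcont : ∀ j, Continuous (partialDeriv j φ) := continuous_partialDeriv hφ
  have h := intervalIntegral.integral_eq_sub_of_hasDerivAt (a := 0) (b := 1)
    (f := fun t : ℝ => φ (x + -(t • s)))
    (f' := fun t => -∑ j, s j * partialDeriv j φ (x + -(t • s))) (fun t _ => ?_)
    (Continuous.intervalIntegrable (by fun_prop) _ _)
  · rw [h]; simp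
  · have h1 : HasDerivAt (fun t : ℝ => x + -(t • s)) (-s) t := by
      simpa using (((hasDerivAt_id t).smul_const s).neg).const_add x
    have h2 := ((hφ.differentiable (by simp)) (x + -(t • s))).hasFDerivAt.comp_hasDerivAt t h1
    rwa [map_neg, fderiv_apply_eq_sum] at h2

lemma integral_intervalIntegral_mul {a : EuclideanSpace ℝ (Fin d) → ℝ → ℝ}
    (ha : Continuous fun z : EuclideanSpace ℝ (Fin d) × ℝ => a z.1 z.2) {M : ℝ}
    (hM : ∀ x t, ‖a x t‖ ≤ M) {f : EuclideanSpace ℝ (Fin d) → ℝ} (hf : Integrable f) :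
    ∫ x, (∫ t in (0 : ℝ)..1, a x t) * f x = ∫ t in (0 : ℝ)..1, ∫ x, a x t * f x := by
  have hint : Integrable (fun z : EuclideanSpace ℝ (Fin d) × ℝ => a z.1 z.2 * f z.1)
      ((volume : Measure (EuclideanSpace ℝ (Fin d))).prod (volume.restrict (Set.Ioc (0 : ℝ) 1))) :=
    (hf.comp_fst _).bdd_mul (c := M) ha.aestronglyMeasurable
      (Filter.Eventually.of_forall fun z => hM _ _)
  simp only [intervalIntegral.integral_of_le zero_le_one, ← integral_mul_const]
  exact integral_integral_swap hint

namespace IsWeakPartials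

variable {θ : EuclideanSpace ℝ (Fin d) → ℝ} {k : Fin d → EuclideanSpace ℝ (Fin d) → ℝ}

/-- The fundamental theorem of calculus for a continuous function with continuous weak partial
derivatives. -/
lemma sub_eq_intervalIntegral (h : IsWeakPartials θ k) (hθ : Continuous θ)
    (hk : ∀ j, Continuous (k j)) (s x : EuclideanSpace ℝ (Fin d)) :
    θ (x + s) - θ x = ∫ t in (0 : ℝ)..1, ∑ j, s j * k j (x + t • s) := by
  set q : EuclideanSpace ℝ (Fin d) → ℝ := fun x => ∑ j, s j * k j x with hq
  have hqc : Continuous q := by fun_prop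
  have hqb : ∃ M, ∀ x, ‖q x‖ ≤ M := by
    choose M hM using fun j => (h.hasCompactSupport_partial j).exists_bound_of_continuous (hk j)
    refine ⟨∑ j, ‖s j‖ * M j, fun x => (norm_sum_le _ _).trans (Finset.sum_le_sum fun j _ => ?_)⟩
    rw [norm_mul]
    gcongr
    exact hM j x
  obtain ⟨M, hM⟩ := hqb
  have hqt : Continuous fun z : EuclideanSpace ℝ (Fin d) × ℝ => q (z.1 + z.2 • s) := by fun_prop
  have hIc : Continuous fun x => ∫ t in (0 : ℝ)..1, q (x + t • s) :=
    intervalIntegral.continuous_parametric_intervalIntegral_of_continuous' hqt 0 1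
  -- Tested against `φ`, the difference moves onto `φ`, where the classical fundamental theorem of
  -- calculus holds. Fubini and the weak derivative then bring it back; continuity of both sides
  -- removes the null set.
  have hae : (fun x => θ (x + s) - θ x) =ᵐ[volume] fun x => ∫ t in (0 : ℝ)..1, q (x + t • s) := by
    have hθs : Continuous fun x => θ (x + s) - θ x := by fun_prop
    refine ae_eq_of_integral_contDiff_smul_eq hθs.locallyIntegrable
      hIc.locallyIntegrable fun φ hφ hs => ?_
    have hφi : Integrable φ := hφ.continuous.integrable_of_hasCompactSupport hs
    obtain ⟨N, hN⟩ := hs.exists_bound_of_continuous hφ.continuous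
    choose P hP using fun j =>
      (hasCompactSupport_partialDeriv hs j).exists_bound_of_continuous (continuous_partialDeriv hφ j)
    have hpc : ∀ j, Continuous (partialDeriv j φ) := continuous_partialDeriv hφ
    have hφθ : ∀ a, Integrable fun x => φ (x + a) * θ x := fun a =>
      h.integrable.bdd_mul (c := N) (hφ.continuous.comp (continuous_add_const a)).aestronglyMeasurable
        (Filter.Eventually.of_forall fun x => hN _)
    have hφk : ∀ a j, Integrable fun x => φ (x + a) * k j x := fun a j =>
      (h.integrable_partial j).bdd_mul (c := N)
        (hφ.continuous.comp (continuous_add_const a)).aestronglyMeasurable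
        (Filter.Eventually.of_forall fun x => hN _)
    have hpθ : ∀ a j, Integrable fun x => partialDeriv j φ (x + a) * θ x := fun a j =>
      h.integrable.bdd_mul (c := P j) ((hpc j).comp (continuous_add_const a)).aestronglyMeasurable
        (Filter.Eventually.of_forall fun x => hP j _)
    have h1 : ∫ x, φ x • (θ (x + s) - θ x) = ∫ x, (φ (x + -s) - φ x) * θ x := by
      have e1 : ∫ x, φ x * θ (x + s) = ∫ x, φ (x + -s) * θ x := by
        rw [← integral_add_right_eq_self (fun x => φ (x + -s) * θ x) s]
        simp
      have e2 : Integrable fun x => φ x * θ (x + s) := by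
        simpa using (hφθ (-s)).comp_add_right s
      have e3 : Integrable fun x => φ x * θ x := by simpa using hφθ 0
      simp only [smul_eq_mul, mul_sub, sub_mul]
      rw [integral_sub e2 e3, integral_sub (hφθ (-s)) e3, e1]
    have h2 : ∫ x, (φ (x + -s) - φ x) * θ x =
        ∫ t in (0 : ℝ)..1, ∫ x, (-∑ j, s j * partialDeriv j φ (x + -(t • s))) * θ x := by
      simp only [sub_eq_intervalIntegral_partialDeriv hφ s]
      refine integral_intervalIntegral_mul (M := ∑ j, ‖s j‖ * P j) (by fun_prop) (fun x t => ?_)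
        h.integrable
      rw [norm_neg]
      refine (norm_sum_le _ _).trans (Finset.sum_le_sum fun j _ => ?_)
      rw [norm_mul]
      gcongr
      exact hP j _
    have h3 : ∀ t : ℝ, ∫ x, (-∑ j, s j * partialDeriv j φ (x + -(t • s))) * θ x =
        ∫ x, q (x + t • s) * φ x := fun t => by
      have e1 : ∀ x, (-∑ j, s j * partialDeriv j φ (x + -(t • s))) * θ x =
          ∑ j, -s j * (partialDeriv j φ (x + -(t • s)) * θ x) := fun x => by
        rw [neg_mul, Finset.sum_mul, ← Finset.sum_neg_distrib]
        exact Finset.sum_congr rfl fun j _ => by ring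
      have e2 : ∀ x, q x * φ (x + -(t • s)) = ∑ j, s j * (φ (x + -(t • s)) * k j x) := fun x => by
        rw [hq, Finset.sum_mul]
        exact Finset.sum_congr rfl fun j _ => by ring
      have e3 : ∫ x, q (x + t • s) * φ x = ∫ x, q x * φ (x + -(t • s)) := by
        rw [← integral_add_right_eq_self (fun x => q x * φ (x + -(t • s))) (t • s)]
        simp
      rw [e3]
      simp only [e1, e2]
      rw [integral_finsetSum _ fun j _ => (hpθ _ j).const_mul _,
        integral_finsetSum _ fun j _ => (hφk _ j).const_mul _]
      refine Finset.sum_congr rfl fun j _ => ?_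
      rw [integral_const_mul, integral_const_mul, h.integral_comp_add hφ hs, neg_mul_neg]
    have h4 : ∫ x, φ x • ∫ t in (0 : ℝ)..1, q (x + t • s) =
        ∫ t in (0 : ℝ)..1, ∫ x, q (x + t • s) * φ x := by
      simp only [smul_eq_mul, mul_comm (φ _)]
      exact integral_intervalIntegral_mul hqt (fun x t => hM _) hφi
    rw [h1, h2, h4]
    simp only [h3]
  exact congrFun ((Continuous.ae_eq_iff_eq volume (by fun_prop) hIc).1 hae) x

lemma interp_sub_eq_intervalIntegral (h : IsWeakPartials θ k) (hθ : Continuous θ)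
    (hk : ∀ j, Continuous (k j)) (u : (Fin d → ℤ) → EuclideanSpace ℝ (Fin m))
    (s x : EuclideanSpace ℝ (Fin d)) :
    interp θ u (x + s) - interp θ u x =
      ∫ t in (0 : ℝ)..1, ∑ j, s j • interp (k j) u (x + t • s) := by
  obtain ⟨R₀, hR₀, hθR⟩ := h.hasCompactSupport.exists_forall_norm_lt_eq_zero
  choose R₁ hR₁ hkR using fun j => (h.hasCompactSupport_partial j).exists_forall_norm_lt_eq_zero
  set R := R₀ + ∑ j, R₁ j
  have hθ' : ∀ x, R < ‖x‖ → θ x = 0 := fun x hx =>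
    hθR x (lt_of_le_of_lt (le_add_of_nonneg_right (Finset.sum_nonneg fun j _ => hR₁ j)) hx)
  have hk' : ∀ j x, R < ‖x‖ → k j x = 0 := fun j x hx => hkR j x (lt_of_le_of_lt
    ((Finset.single_le_sum (fun j _ => hR₁ j) (Finset.mem_univ j)).trans
      (le_add_of_nonneg_left hR₀)) hx)
  set S := latticeBall d (R + (‖x‖ + ‖s‖))
  have h1 : ∀ t ∈ Set.uIcc (0 : ℝ) 1, ∑ j, s j • interp (k j) u (x + t • s) =
      ∑ ξ ∈ S, (∑ j, s j * k j (x - site ξ + t • s)) • u ξ := fun t ht => by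
    rw [Set.uIcc_of_le zero_le_one] at ht
    have hx : ‖x + t • s‖ ≤ ‖x‖ + ‖s‖ := by
      refine (norm_add_le _ _).trans ?_
      rw [norm_smul, Real.norm_eq_abs, abs_of_nonneg ht.1]
      gcongr
      exact mul_le_of_le_one_left (norm_nonneg _) ht.2
    simp only [interp_eq_sum (hk' _) u hx, Finset.smul_sum, smul_smul, Finset.sum_smul]
    rw [Finset.sum_comm]
    simp only [add_sub_right_comm]
    rfl
  rw [intervalIntegral.integral_congr h1, intervalIntegral.integral_finsetSum]
  · rw [interp_eq_sum hθ' u (norm_add_le x s),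
      interp_eq_sum hθ' u (le_add_of_nonneg_right (norm_nonneg s)), ← Finset.sum_sub_distrib]
    refine Finset.sum_congr rfl fun ξ _ => ?_
    rw [intervalIntegral.integral_smul_const, ← h.sub_eq_intervalIntegral hθ hk, ← sub_smul,
      add_sub_right_comm]
  · intro ξ _
    exact Continuous.intervalIntegrable (by fun_prop) _ _

/-- The difference is an average, along the segment in direction `s`, of translates of the
directional derivative, so averaging does not increase the norm. -/
lemma eLpNorm_interp_sub_le (h : IsWeakPartials θ k) (hθ : Continuous θ)
    (hk : ∀ j, Continuous (k j)) (u : (Fin d → ℤ) → EuclideanSpace ℝ (Fin m))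
    (s : EuclideanSpace ℝ (Fin d)) {p : ℝ≥0∞} (hp : 1 ≤ p) :
    eLpNorm (fun x => interp θ u (x + s) - interp θ u x) p volume ≤
      (∑ j, ‖s j‖₊ : ℝ≥0) * eLpNorm (interpGrad k u) p volume := by
  set g : EuclideanSpace ℝ (Fin d) → EuclideanSpace ℝ (Fin m) := fun x =>
    ∑ j, s j • interp (k j) u x with hg
  have hkc : ∀ j, Continuous (interp (k j) u) := fun j =>
    continuous_interp (hk j) (h.hasCompactSupport_partial j) u
  have hgc : Continuous g := by fun_prop
  have hprob : IsProbabilityMeasure (volume.restrict (Set.Ioc (0 : ℝ) 1)) := ⟨by simp⟩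
  have hmap : Measurable fun t : ℝ => -(t • s) := by fun_prop
  let μ : Measure (EuclideanSpace ℝ (Fin d)) :=
    (volume.restrict (Set.Ioc (0 : ℝ) 1)).map fun t : ℝ => -(t • s)
  have hμ : IsProbabilityMeasure μ := Measure.isProbabilityMeasure_map hmap.aemeasurable
  have h1 : (fun x => interp θ u (x + s) - interp θ u x) = fun x => ∫ y, g (x - y) ∂μ := by
    ext1 x
    have h2 : ∫ y, g (x - y) ∂μ = ∫ t in Set.Ioc (0 : ℝ) 1, g (x - -(t • s)) :=
      integral_map hmap.aemeasurable
        (Continuous.aestronglyMeasurable (by fun_prop : Continuous fun y => g (x - y)))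
    rw [h.interp_sub_eq_intervalIntegral hθ hk, intervalIntegral.integral_of_le zero_le_one, h2]
    simp only [sub_neg_eq_add, hg]
  rw [h1]
  refine (eLpNorm_integral_translate_le μ hgc.stronglyMeasurable hp).trans ?_
  refine eLpNorm_le_nnreal_smul_eLpNorm_of_ae_le_mul
    (Filter.Eventually.of_forall fun x => ?_) p
  rw [Finset.sum_mul]
  refine (nnnorm_sum_le _ _).trans (Finset.sum_le_sum fun j _ => ?_)
  rw [nnnorm_smul]
  gcongr
  exact PiLp.nnnorm_apply_le (interpGrad k u x) j

end IsWeakPartials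

/-! ### Comparison of the gradients of the two interpolants -/

lemma interp_sub {k : EuclideanSpace ℝ (Fin d) → ℝ} (hs : HasCompactSupport k)
    (u v : (Fin d → ℤ) → EuclideanSpace ℝ (Fin m)) (x : EuclideanSpace ℝ (Fin d)) :
    interp k (fun ξ => u ξ - v ξ) x = interp k u x - interp k v x := by
  obtain ⟨R, -, hR⟩ := hs.exists_forall_norm_lt_eq_zero
  simp only [interp_eq_sum hR _ le_rfl, smul_sub, Finset.sum_sub_distrib]

namespace IsNodalBasis

variable {ζ : EuclideanSpace ℝ (Fin d) → ℝ} {k : Fin d → EuclideanSpace ℝ (Fin d) → ℝ}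

/-- Constants are reproduced, so their interpolated gradient is a weak gradient of a constant and
vanishes almost everywhere by uniqueness. -/
lemma ae_interp_const_eq_zero (hζ : IsNodalBasis ζ) (hk : IsWeakPartials ζ k)
    (c : EuclideanSpace ℝ (Fin m)) : ∀ᵐ x, ∀ j, interp (k j) (fun _ => c) x = 0 := by
  have h1 : interp ζ (fun _ => c) = fun _ => c := by
    obtain ⟨R, -, hR⟩ := hζ.hasCompactSupport'
    ext1 x
    rw [interp_eq_sum hR _ le_rfl, ← Finset.sum_smul, hζ.sum_eq_one hR le_rfl, one_smul]
  have h2 := hk.isWeakGradient_interp fun _ => c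
  rw [h1] at h2
  filter_upwards [h2.ae_eq (isWeakGradient_const c)] with x hx j
  exact congrArg (fun v => v j) hx

/-- The gradient of the interpolant is controlled by finitely many lattice differences. -/
lemma exists_eLpNorm_interpGrad_le (hζ : IsNodalBasis ζ) (hk : IsWeakPartials ζ k)
    (hb : ∃ M : ℝ, ∀ j x, ‖k j x‖ ≤ M) : ∃ (S : Finset (Fin d → ℤ)) (C : ℝ≥0),
      ∀ (u : (Fin d → ℤ) → EuclideanSpace ℝ (Fin m)) (p : ℝ≥0∞), 1 ≤ p →
        eLpNorm (interpGrad k u) p volume ≤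
          C * ∑ η ∈ S, latticeNorm p fun ξ => u (ξ + η) - u ξ := by
  obtain ⟨M, hM⟩ := hb
  choose R₁ hR₁ hkR using fun j => (hk.hasCompactSupport_partial j).exists_forall_norm_lt_eq_zero
  have hkR' : ∀ j x, ∑ j, R₁ j < ‖x‖ → k j x = 0 := fun j x hx => hkR j x (lt_of_le_of_lt
    (Finset.single_le_sum (fun j _ => hR₁ j) (Finset.mem_univ j)) hx)
  set S := latticeBall d (∑ j, R₁ j + d)
  refine ⟨S, d * M.toNNReal, fun u p hp => ?_⟩
  refine eLpNorm_le_sum_latticeNorm S (fun η ξ => u (ξ + η) - u ξ) (d * M.toNNReal) ?_ hp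
  -- The constant to subtract, `u (nearest x)`, varies with `x`, but takes countably many values, so
  -- one null set suffices.
  filter_upwards [ae_all_iff.2 fun η => hζ.ae_interp_const_eq_zero hk (u η)] with x hx
  have hj : ∀ j, ‖interp (k j) u x‖ ≤
      ∑ η ∈ S, M.toNNReal * ‖u (nearest x + η) - u (nearest x)‖ := fun j => by
    have h1 : interp (k j) u x = ∑ η ∈ S, k j (x - site (nearest x) - site η) •
        (u (nearest x + η) - u (nearest x)) := by
      have h2 := interp_sub (hk.hasCompactSupport_partial j) u (fun _ => u (nearest x)) x
      rw [hx (nearest x) j, sub_zero] at h2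
      rw [← h2]
      conv_lhs => rw [← sub_add_cancel x (site (nearest x)), interp_add_site,
        interp_eq_sum (hkR' j) _ (norm_sub_site_nearest_le x)]
      refine Finset.sum_congr rfl fun η _ => ?_
      rw [sub_add_cancel, add_comm η]
    rw [h1]
    refine (norm_sum_le _ _).trans (Finset.sum_le_sum fun η _ => ?_)
    rw [norm_smul]
    gcongr
    exact (hM j _).trans (Real.le_coe_toNNReal M)
  calc ‖interpGrad k u x‖ ≤ ∑ j, ‖interp (k j) u x‖ := by
        have h1 : interpGrad k u x =
            ∑ j, PiLp.single 2 j (interp (k j) u x) := by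
          ext j : 1
          simp [interpGrad, Finset.sum_apply]
        rw [h1]
        refine (norm_sum_le _ _).trans (Finset.sum_le_sum fun j _ => ?_)
        simp
    _ ≤ ∑ _j : Fin d, ∑ η ∈ S, M.toNNReal * ‖u (nearest x + η) - u (nearest x)‖ :=
        Finset.sum_le_sum fun j _ => hj j
    _ = _ := by simp [Finset.mul_sum, mul_assoc]

lemma isWeakPartials_mollify (hζ : IsNodalBasis ζ) (hk : IsWeakPartials ζ k) :
    IsWeakPartials (mollify ζ ζ) fun j => mollify ζ (k j) :=
  hk.mollify hζ.integrable hζ.hasCompactSupport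

lemma isWeakGradient_quasiInterp (hζ : IsNodalBasis ζ) (hk : IsWeakPartials ζ k)
    (u : (Fin d → ℤ) → EuclideanSpace ℝ (Fin m)) :
    IsWeakGradient (quasiInterp ζ u) (interpGrad (fun j => mollify ζ (k j)) u) := by
  rw [hζ.quasiInterp_eq]
  exact (hζ.isWeakPartials_mollify hk).isWeakGradient_interp u

lemma eLpNorm_interpGrad_mollify_le (hζ : IsNodalBasis ζ) (hk : IsWeakPartials ζ k)
    (u : (Fin d → ℤ) → EuclideanSpace ℝ (Fin m)) {p : ℝ≥0∞} (hp : 1 ≤ p) :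
    eLpNorm (interpGrad (fun j => mollify ζ (k j)) u) p volume ≤
      eLpNorm (interpGrad k u) p volume := by
  have hG := (hk.isWeakGradient_interp u).locallyIntegrable_grad
  have h1 : interpGrad (fun j => mollify ζ (k j)) u =
      fun x => ∫ y, ζ (x - y) • interpGrad k u y := by
    ext x j : 2
    have hs : HasCompactSupport fun y => ζ (x - y) :=
      hζ.hasCompactSupport.comp_homeomorph (Homeomorph.subLeft x)
    have hc : Continuous fun y => ζ (x - y) := hζ.continuous.comp (by fun_prop)
    rw [eval_integral_piLp fun j => (locallyIntegrable_apply hG j).integrable_smul_left_of_hasCompactSupport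
      hc hs]
    exact (integral_smul_interp hζ.continuous hζ.hasCompactSupport (hk.integrable_partial j)
      (hk.hasCompactSupport_partial j) u x).symm
  rw [h1]
  exact eLpNorm_mollify_le hζ.continuous hζ.hasCompactSupport hζ.nonneg hζ.integral_eq_one
    hG.aestronglyMeasurable hp

/-- Lattice differences are the bridge: they bound `∇ū`, the stability estimate bounds them by
differences of `ũ`, and those are bounded by `∇ũ`. -/
lemma exists_eLpNorm_interpGrad_le_mollify (hζ : IsNodalBasis ζ) (hk : IsWeakPartials ζ k)
    (hb : ∃ M : ℝ, ∀ j x, ‖k j x‖ ≤ M) : ∃ C : ℝ≥0, 0 < C ∧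
      ∀ (u : (Fin d → ℤ) → EuclideanSpace ℝ (Fin m)) (p : ℝ≥0∞), 1 ≤ p →
        eLpNorm (interpGrad k u) p volume ≤
          C * eLpNorm (interpGrad (fun j => mollify ζ (k j)) u) p volume := by
  obtain ⟨S, C, hC⟩ := hζ.exists_eLpNorm_interpGrad_le (m := m) hk hb
  obtain ⟨K, hK, hstab⟩ := hζ.latticeNorm_le_eLpNorm_quasiInterp (m := m)
  have hsupp := hasCompactSupport_mollify hζ.hasCompactSupport hζ.hasCompactSupport
  refine ⟨C * ∑ η ∈ S, K * (∑ j, ‖site η j‖₊) + 1, by positivity, fun u p hp => ?_⟩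
  calc eLpNorm (interpGrad k u) p volume
      ≤ C * ∑ η ∈ S, latticeNorm p fun ξ => u (ξ + η) - u ξ := hC u p hp
    _ ≤ C * ∑ η ∈ S, K * ((∑ j, ‖site η j‖₊ : ℝ≥0) *
          eLpNorm (interpGrad (fun j => mollify ζ (k j)) u) p volume) := by
        gcongr with η _
        refine (hstab _ p hp).trans ?_
        gcongr
        have h1 : quasiInterp ζ (fun ξ => u (ξ + η) - u ξ) = fun x =>
            interp (mollify ζ ζ) u (x + site η) - interp (mollify ζ ζ) u x := by
          ext1 x
          rw [hζ.quasiInterp_eq, interp_sub hsupp, interp_add_site]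
        rw [h1]
        exact (hζ.isWeakPartials_mollify hk).eLpNorm_interp_sub_le hζ.continuous_mollify
          (fun j => LatticeInterp.continuous_mollify hζ.continuous hζ.hasCompactSupport (hk.integrable_partial j))
          u (site η) hp
    _ = (C * ∑ η ∈ S, K * (∑ j, ‖site η j‖₊) : ℝ≥0) *
          eLpNorm (interpGrad (fun j => mollify ζ (k j)) u) p volume := by
        push_cast
        rw [mul_assoc, Finset.sum_mul]
        simp only [mul_assoc]
    _ ≤ _ := by
        gcongr
        exact le_self_add

end IsNodalBasis

end LatticeInterp

end

theorem theorem2p2 {d m : ℕ} (ζ : EuclideanSpace ℝ (Fin d) → ℝ)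
    (hζ : LatticeInterp.IsNodalBasis ζ) :
    ∃ c₀ c₁ c₂ c₁' : ℝ≥0, 0 < c₀ ∧ 0 < c₁ ∧ 0 < c₂ ∧ 0 < c₁' ∧
      ∀ u : (Fin d → ℤ) → EuclideanSpace ℝ (Fin m),
        -- bounds for the function values
        (∀ p : ℝ≥0∞, 1 ≤ p →
          (p ≠ ⊤ → (∀ x, ζ (-x) = ζ x) → LatticeInterp.PolynomialGrowth u →
            (c₀ : ℝ≥0∞) * c₁ * LatticeInterp.latticeNorm p u ≤
              c₁ * LatticeInterp.latticeNorm p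
                (fun ξ => LatticeInterp.quasiInterp ζ u (LatticeInterp.site ξ))) ∧
          (p ≠ ⊤ →
            (c₀ : ℝ≥0∞) * c₁ * LatticeInterp.latticeNorm p u ≤
              eLpNorm (LatticeInterp.quasiInterp ζ u) p volume) ∧
          c₁ * LatticeInterp.latticeNorm p
              (fun ξ => LatticeInterp.quasiInterp ζ u (LatticeInterp.site ξ)) ≤
            eLpNorm (LatticeInterp.quasiInterp ζ u) p volume ∧
          eLpNorm (LatticeInterp.quasiInterp ζ u) p volume ≤
            eLpNorm (LatticeInterp.interp ζ u) p volume ∧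
          eLpNorm (LatticeInterp.interp ζ u) p volume ≤
            c₂ * LatticeInterp.latticeNorm p u) ∧
        -- bounds for the weak gradients, which exist
        (∃ G, LatticeInterp.IsWeakGradient (LatticeInterp.interp ζ u) G) ∧
        (∃ H, LatticeInterp.IsWeakGradient (LatticeInterp.quasiInterp ζ u) H) ∧
        ∀ G H, LatticeInterp.IsWeakGradient (LatticeInterp.interp ζ u) G →
          LatticeInterp.IsWeakGradient (LatticeInterp.quasiInterp ζ u) H →
          ∀ p : ℝ≥0∞, 1 ≤ p →
            (p ≠ ⊤ → c₁' * eLpNorm G p volume ≤ eLpNorm H p volume) ∧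
            eLpNorm H p volume ≤ eLpNorm G p volume := by
  have hinv : ∀ {C : ℝ≥0} {a b : ℝ≥0∞}, 0 < C → a ≤ C * b → (C⁻¹ : ℝ≥0) * a ≤ b := by
    intro C a b hC h
    rw [ENNReal.coe_inv hC.ne']
    exact (ENNReal.inv_mul_le_iff (by simpa using hC.ne') ENNReal.coe_ne_top).2 h
  obtain ⟨k, hk, hb⟩ := hζ.exists_isWeakPartials
  obtain ⟨A, hA, hlattice⟩ : ∃ A : ℝ≥0, 0 < A ∧ ((∀ x, ζ (-x) = ζ x) →
      ∀ u : (Fin d → ℤ) → EuclideanSpace ℝ (Fin m), LatticeInterp.PolynomialGrowth u →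
        ∀ p : ℝ≥0∞, 1 ≤ p → LatticeInterp.latticeNorm p u ≤
          A * LatticeInterp.latticeNorm p
            fun ξ => LatticeInterp.quasiInterp ζ u (LatticeInterp.site ξ)) := by
    by_cases hsymm : ∀ x, ζ (-x) = ζ x
    · obtain ⟨A, hA, h⟩ := hζ.latticeNorm_le_latticeNorm_quasiInterp (m := m) hsymm
      exact ⟨A, hA, fun _ => h⟩
    -- Without evenness nothing is claimed, and any positive constant serves.
    · exact ⟨1, one_pos, fun h => absurd h hsymm⟩
  obtain ⟨B, hB, hstab⟩ := hζ.latticeNorm_le_eLpNorm_quasiInterp (m := m)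
  obtain ⟨C₁, hC₁, hloc⟩ := LatticeInterp.latticeNorm_interp_le (m := m) hζ.continuous_mollify
    (LatticeInterp.hasCompactSupport_mollify hζ.hasCompactSupport hζ.hasCompactSupport) 0
  obtain ⟨C₂, hC₂, hup⟩ :=
    LatticeInterp.eLpNorm_interp_le (m := m) hζ.continuous hζ.hasCompactSupport
  obtain ⟨D, hD, hgrad⟩ := hζ.exists_eLpNorm_interpGrad_le_mollify (m := m) hk hb
  -- The single `c₀` serves two bounds: `c₀ ≤ A⁻¹` for lattice values of `ũ`, and `c₀ c₁ ≤ B⁻¹` for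
  -- its `L^p` norm, with `c₁ = C₁⁻¹`.
  refine ⟨min A⁻¹ (B⁻¹ * C₁), C₁⁻¹, C₂, D⁻¹, by positivity, by positivity, hC₂, by positivity,
    fun u => ⟨fun p hp => ⟨fun _ hsymm hu => ?_, fun _ => ?_, hinv hC₁ ?_,
      hζ.eLpNorm_quasiInterp_le u hp, hup u p hp⟩, ⟨_, hk.isWeakGradient_interp u⟩,
      ⟨_, hζ.isWeakGradient_quasiInterp hk u⟩, fun G H hG hH p hp => ?_⟩⟩
  · rw [mul_comm (_ : ℝ≥0∞) ((C₁⁻¹ : ℝ≥0) : ℝ≥0∞), mul_assoc]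
    gcongr
    refine le_trans ?_ (hinv hA (hlattice hsymm u hu p hp))
    gcongr
    exact min_le_left _ _
  · refine le_trans ?_ (hinv hB (hstab u p hp))
    rw [← ENNReal.coe_mul]
    gcongr
    calc min A⁻¹ (B⁻¹ * C₁) * C₁⁻¹ ≤ B⁻¹ * C₁ * C₁⁻¹ := by gcongr; exact min_le_right _ _
      _ = B⁻¹ := mul_inv_cancel_right₀ hC₁.ne' _
  · have h := hloc u p hp
    rw [← hζ.quasiInterp_eq] at h
    simpa only [zero_add] using h
  · rw [eLpNorm_congr_ae (hG.ae_eq (hk.isWeakGradient_interp u)),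
      eLpNorm_congr_ae (hH.ae_eq (hζ.isWeakGradient_quasiInterp hk u))]
    exact ⟨fun _ => hinv hD (hgrad u p hp), hζ.eLpNorm_interpGrad_mollify_le hk u hp⟩
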